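/- Let $d,k,l\ge 1$ be integers with $l>2kd+1$, and let $\lambda_1,\dots,\lambda_d\in\mathbb C$ with $|\lambda_j|=1$ be one-resonant of index $(1,\dots,1)$: for $j\in\{1,\dots,d\}$ and $m\in\mathbb N^d$ one has $\lambda_j=\lambda_1^{m_1}\cdots\lambda_d^{m_d}$ if and only if $m=(q,\dots,q)+e_j$ for some $q\in\mathbb N$. Let $F$ be (a representative of) a holomorphic germ at $0\in\mathbb C^d$ of the form $$F(z)=(\lambda_1z^1,\dots,\lambda_dz^d)\Bigl(1-\frac{(z^1\cdots z^d)^k}{kd}\Bigr)+O(\|z\|^l)\qquad(z\to0).$$ Let $0<\beta<1/d$ with $\beta(l+d-1)>2k+1$ and $0<\theta<\pi/(2k)$. For $R>0$ and $h=0,\dots,k-1$ let $B_h=B_h(R,\theta,\beta)$ be the set of all $z\in\mathbb C^d$ such that, with $u=z^1\cdots z^d$, $$|z^j|<|u|^{\beta}\ (1\le j\le d),\qquad \Bigl|u^k-\tfrac1{2R}\Bigr|<\tfrac1{2R},\qquad \bigl|\arg u-\tfrac{2\pi h}{k}\bigr|<\theta \pmod{2\pi}.$$ Call a non-empty open set $B$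 a uniform local basin of attraction of $F$ if $F(B)\subseteq B$ and $F^n\to0$ uniformly on $B$. Then there is $R>0$ such that $B_0,\dots,B_{k-1}$ are uniform local basins of attraction of $F$. Moreover, for every $R>0$ for which this holds, every $h\in\{0,\dots,k-1\}$ and every $z\in B_h$, the orbit $z_n=F^n(z)$ does not converge to $0$ tangent to a proper complex subspace of $\mathbb C^d$; that is, there is no complex linear subspace $V\subsetneq\mathbb C^d$ with $z_n\to0$ and $\operatorname{dist}(z_n,V)=o(\|z_n\|)$. Furthermore, if $\omega(z)$ denotes the set of accumulation points of the sequence $(z_n/\|z_n\|)_n$, the real cone $\mathbb R_{\ge0}\cdot\omega(z)$ is not contained in any proper complex subspace, i.e. its complex linear span is $\mathbb C^d$. -/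

import Mathlib

open Filter Topology Asymptotics

noncomputable section

namespace OneResonantBasins

/-- The numbers `lam 1, …, lam d` are one-resonant of index `α`: a resonance
`lam j = lam 1 ^ m 1 ⋯ lam d ^ m d` holds if and only if `m = q α + e_j` for some `q ∈ ℕ`. -/
def OneResonant {d : ℕ} (α : Fin d → ℕ) (lam : Fin d → ℂ) : Prop :=
  ∀ (j : Fin d) (m : Fin d → ℕ),
    lam j = ∏ i, lam i ^ m i ↔ ∃ q : ℕ, m = q • α + Pi.single j 1

/-- The product of the coordinates, `u = z^1 ⋯ z^d`. -/
def coordProd {d : ℕ} (z : EuclideanSpace ℂ (Fin d)) : ℂ := ∏ i, z i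

/-- The normal form `z ↦ Λ z (1 - (z^1 ⋯ z^d)^k / (k d))`, where `Λ = diag(lam)`. -/
def normalForm {d : ℕ} (k : ℕ) (lam : Fin d → ℂ) (z : EuclideanSpace ℂ (Fin d)) :
    EuclideanSpace ℂ (Fin d) :=
  WithLp.toLp 2 fun j => lam j * z j * (1 - coordProd z ^ k / ((k : ℂ) * (d : ℂ)))

/-- The attracting sector around the direction `exp (2πih/k)`. The condition on the argument is
read modulo `2π`: the number `u` is rotated by `-2πh/k` before its principal argument is taken. -/
def sector (k h : ℕ) (R θ : ℝ) : Set ℂ :=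
  {u | ‖u ^ k - ((1 / (2 * R) : ℝ) : ℂ)‖ < 1 / (2 * R) ∧
    |Complex.arg (u * Complex.exp (-(2 * Real.pi * h / k * Complex.I)))| < θ}

/-- `W(β)`, the points with `|z^j| < |z^1 ⋯ z^d| ^ β` for every `j`. -/
def regionW (d : ℕ) (β : ℝ) : Set (EuclideanSpace ℂ (Fin d)) :=
  {z | ∀ j, ‖z j‖ < ‖coordProd z‖ ^ β}

/-- The set `B_h(R, θ, β)`. -/
def basin (d k h : ℕ) (R θ β : ℝ) : Set (EuclideanSpace ℂ (Fin d)) :=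
  {z | z ∈ regionW d β ∧ coordProd z ∈ sector k h R θ}

/-- A non-empty open set `B` is a uniform local basin of attraction (to the origin) of `F` if `F`
maps `B` to itself and the iterates of `F` converge to `0` uniformly on `B`. -/
structure IsUniformLocalBasin {d : ℕ}
    (F : EuclideanSpace ℂ (Fin d) → EuclideanSpace ℂ (Fin d))
    (B : Set (EuclideanSpace ℂ (Fin d))) : Prop where
  isOpen : IsOpen B
  nonempty : B.Nonempty
  mapsTo : Set.MapsTo F B B
  tendsto_zero : TendstoUniformlyOn (fun n => F^[n]) (fun _ => 0) atTop B

/-- The sequence `x` converges to `0` tangent to the complex subspace `V`: it converges to `0`, and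
the distance of `x n` to `V` is `o(‖x n‖)`. -/
def ConvergesTangentTo {d : ℕ} (x : ℕ → EuclideanSpace ℂ (Fin d))
    (V : Submodule ℂ (EuclideanSpace ℂ (Fin d))) : Prop :=
  Tendsto x atTop (𝓝 0) ∧
    (fun n => Metric.infDist (x n) (V : Set (EuclideanSpace ℂ (Fin d)))) =o[atTop]
      (fun n => ‖x n‖)

/-- The set of accumulation points of the directions `x n / ‖x n‖`. -/
def limitDirections {d : ℕ} (x : ℕ → EuclideanSpace ℂ (Fin d)) :
    Set (EuclideanSpace ℂ (Fin d)) :=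
  {w | MapClusterPt w atTop fun n => (‖x n‖⁻¹ : ℝ) • x n}

/-- The real cone `ℝ_{≥ 0} · ω` over the set `ω` of accumulation points of directions. -/
def limitCone {d : ℕ} (x : ℕ → EuclideanSpace ℂ (Fin d)) : Set (EuclideanSpace ℂ (Fin d)) :=
  {y | ∃ t : ℝ, 0 ≤ t ∧ ∃ w ∈ limitDirections x, y = t • w}

end OneResonantBasins

end

/-! Everything is governed by the product of coordinates `u`. The resonance with `q = 1` gives `∏
lam i = 1`, so the rotations cancel in `u`. On `regionW` every coordinate is below `|u|^β`, and
`β(l+d-1) > 2k+1` turns the error of `F` into `u' = u(1 - u^k/k) + O(|u|^(2k+1))`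
(`exists_local_estimates`). With `U = u^(-k)` this is `U' = U + 1 + O(|u|^k)`. The disc condition
becomes `Re U > R` and the sector a cone around the positive axis; both persist for small `u`, and
`Re U` grows by at least `1/2` per step (`exists_sector_step`). The bounds `|z^j| < |u|^β` persist
because a coordinate shrinks by about `1 - Re(u^k)/(kd)` and `|u|^β` only by about `1 - β
Re(u^k)/k`, where `β < 1/d` (`exists_norm_add_lt_rpow`).

For directions, `|u_n|^k = O(1/n)` makes `|u_n|^(2k)` summable. Dividing coordinate `j` by `lam j ^
n` and by the common product `p n` of the factors `1 - u_i^k/(kd)` gives a convergent sequence. The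
product of the limits is a non-zero infinite product, so no limit vanishes
(`exists_coordinate_asymptotics`). A linear form that is `o(‖z_n‖)` on the orbit therefore yields an
exponential sum in the `lam j` tending to zero. These are distinct by the resonance hypothesis, so
the form is zero (`linearMap_eq_zero_of_orbit`). Both conclusions follow by duality, since a proper
subspace lies in the kernel of a non-zero form. -/

namespace OneResonantBasins

/-! ### Elementary estimates -/

/-- Factors are exchanged one at a time. The extra `A` on the left avoids the exponent `card - 1`.
-/
lemma norm_prod_sub_prod_mul_le {ι : Type*} (s : Finset ι) (a b : ι → ℂ) {A G : ℝ} (hA : 0 ≤ A)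
    (ha : ∀ i ∈ s, ‖a i‖ ≤ A) (hb : ∀ i ∈ s, ‖b i‖ ≤ A) (hab : ∀ i ∈ s, ‖a i - b i‖ ≤ G) :
    ‖∏ i ∈ s, a i - ∏ i ∈ s, b i‖ * A ≤ s.card * A ^ s.card * G := by
  classical
  induction s using Finset.induction_on with
  | empty => simp
  | insert i s hi ih =>
    have ih' := ih (fun j hj => ha j (Finset.mem_insert_of_mem hj))
      (fun j hj => hb j (Finset.mem_insert_of_mem hj))
      (fun j hj => hab j (Finset.mem_insert_of_mem hj))
    have hai := ha i (Finset.mem_insert_self i s)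
    have habi := hab i (Finset.mem_insert_self i s)
    have hG : 0 ≤ G := (norm_nonneg _).trans habi
    have hprod : ‖∏ j ∈ s, b j‖ ≤ A ^ s.card := by
      rw [norm_prod, ← Finset.prod_const]
      exact Finset.prod_le_prod (fun _ _ => norm_nonneg _)
        (fun j hj => hb j (Finset.mem_insert_of_mem hj))
    rw [Finset.prod_insert hi, Finset.prod_insert hi, Finset.card_insert_of_notMem hi]
    have hsplit : a i * ∏ j ∈ s, a j - b i * ∏ j ∈ s, b j
        = a i * (∏ j ∈ s, a j - ∏ j ∈ s, b j) + (a i - b i) * ∏ j ∈ s, b j := by ring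
    calc ‖a i * ∏ j ∈ s, a j - b i * ∏ j ∈ s, b j‖ * A
        ≤ (‖a i‖ * ‖∏ j ∈ s, a j - ∏ j ∈ s, b j‖ + ‖a i - b i‖ * ‖∏ j ∈ s, b j‖) * A := by
          rw [hsplit]
          gcongr
          refine (norm_add_le _ _).trans ?_
          rw [norm_mul, norm_mul]
      _ = ‖a i‖ * (‖∏ j ∈ s, a j - ∏ j ∈ s, b j‖ * A) + ‖a i - b i‖ * ‖∏ j ∈ s, b j‖ * A := by
          ring
      _ ≤ A * (s.card * A ^ s.card * G) + G * A ^ s.card * A := by gcongr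
      _ = ((s.card + 1 : ℕ) : ℝ) * A ^ (s.card + 1) * G := by push_cast; ring

lemma exists_norm_one_add_pow_sub_le (n : ℕ) :
    ∃ D : ℝ, 0 ≤ D ∧ ∀ x : ℂ, ‖x‖ ≤ 1 → ‖(1 + x) ^ n - (1 + n * x)‖ ≤ D * ‖x‖ ^ 2 := by
  induction n with
  | zero => exact ⟨0, le_rfl, fun x _ => by simp⟩
  | succ n ih =>
    obtain ⟨D, hD, h⟩ := ih
    refine ⟨2 * D + n, by positivity, fun x hx => ?_⟩
    have hsplit : (1 + x) ^ (n + 1) - (1 + (n + 1 : ℕ) * x)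
        = (1 + x) * ((1 + x) ^ n - (1 + n * x)) + n * x ^ 2 := by push_cast; ring
    have h1 : ‖1 + x‖ ≤ 2 := by
      refine (norm_add_le _ _).trans ?_
      rw [norm_one]; linarith
    rw [hsplit]
    calc _ ≤ ‖1 + x‖ * ‖(1 + x) ^ n - (1 + n * x)‖ + n * ‖x‖ ^ 2 := by
          refine (norm_add_le _ _).trans ?_
          rw [norm_mul, norm_mul, norm_pow, Complex.norm_natCast]
      _ ≤ 2 * (D * ‖x‖ ^ 2) + n * ‖x‖ ^ 2 := by gcongr; exact h x hx
      _ = _ := by ring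

/-- One step of the map `w ↦ w (1 - w ^ k / k) + O(|w| ^ (2k+1))`, in the coordinate
`(w ^ k)⁻¹`, is a translation by one up to a small error. -/
lemma exists_norm_inv_pow_sub_le {k : ℕ} (hk : 1 ≤ k) {C : ℝ} (hC : 0 ≤ C) :
    ∃ L : ℝ, 0 ≤ L ∧ ∃ r : ℝ, 0 < r ∧ ∀ w w' : ℂ, w ≠ 0 → ‖w‖ < r →
      ‖w' - w * (1 - w ^ k / k)‖ ≤ C * ‖w‖ ^ (2 * k + 1) →
      w' ≠ 0 ∧ ‖w' / w - 1‖ ≤ L * ‖w‖ ^ k ∧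
        ‖(w' ^ k)⁻¹ - ((w ^ k)⁻¹ + 1)‖ ≤ L * ‖w‖ ^ k := by
  obtain ⟨D, hD, hexp⟩ := exists_norm_one_add_pow_sub_le k
  have hk0 : (k : ℂ) ≠ 0 := by exact_mod_cast (by omega : k ≠ 0)
  have hk1 : (1 : ℝ) ≤ k := by exact_mod_cast hk
  set K : ℝ := 1 + C with hK
  set M : ℝ := D * K ^ 2 + k * C with hM
  have hK0 : 1 ≤ K := by linarith
  have hM0 : 0 ≤ M := by positivity
  refine ⟨2 * (1 + 2 * M) + K, by positivity, min (1 / K) (1 / (2 * (1 + M))), by positivity,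
    fun w w' hw hwr hww => ?_⟩
  have hwn : 0 < ‖w‖ := norm_pos_iff.2 hw
  set s : ℂ := w ^ k with hs
  have hsn : ‖s‖ = ‖w‖ ^ k := norm_pow _ _
  have hs0 : s ≠ 0 := pow_ne_zero _ hw
  have hspos : 0 < ‖s‖ := norm_pos_iff.2 hs0
  have hw1 : ‖w‖ ≤ 1 := by
    refine (hwr.le.trans (min_le_left _ _)).trans ?_
    rw [div_le_one (by positivity)]; exact hK0
  have hsw : ‖s‖ ≤ ‖w‖ := by
    rw [hsn]; exact pow_le_of_le_one hwn.le hw1 (by omega)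
  have hs1 : ‖s‖ ≤ 1 := hsw.trans hw1
  have hsK : K * ‖s‖ ≤ 1 := by
    have := hsw.trans (hwr.le.trans (min_le_left _ _))
    rw [le_div_iff₀ (by positivity)] at this
    linarith
  have hsM : (1 + M) * ‖s‖ ≤ 1 / 2 := by
    have := hsw.trans (hwr.le.trans (min_le_right _ _))
    rw [le_div_iff₀ (by positivity)] at this
    linarith
  -- The relative increment is `-s/k` to first order, hence `(1 + e)^k` is `1 - s` up to `O(|s|^2)`.
  set e : ℂ := w' / w - 1 with he
  have hwe : w' = w * (1 + e) := by rw [he]; field_simp; ring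
  have he1 : ‖e + s / k‖ ≤ C * ‖s‖ ^ 2 := by
    have h1 : w' - w * (1 - s / k) = w * (e + s / k) := by rw [hwe]; ring
    rw [h1, norm_mul] at hww
    have h2 : C * ‖w‖ ^ (2 * k + 1) = ‖w‖ * (C * ‖s‖ ^ 2) := by rw [hsn]; ring
    rw [h2] at hww
    exact le_of_mul_le_mul_left hww hwn
  have heK : ‖e‖ ≤ K * ‖s‖ := by
    have h1 : ‖s / k‖ ≤ ‖s‖ := by
      rw [norm_div, Complex.norm_natCast]
      exact div_le_self (norm_nonneg _) hk1
    have h2 : ‖s‖ ^ 2 ≤ ‖s‖ := pow_le_of_le_one (norm_nonneg _) hs1 (by norm_num)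
    calc ‖e‖ = ‖(e + s / k) - s / k‖ := by rw [add_sub_cancel_right]
      _ ≤ C * ‖s‖ ^ 2 + ‖s‖ := (norm_sub_le _ _).trans (add_le_add he1 h1)
      _ ≤ C * ‖s‖ + ‖s‖ := by gcongr
      _ = K * ‖s‖ := by rw [hK]; ring
  set y : ℂ := (1 + e) ^ k with hy
  have hE : ‖y - (1 - s)‖ ≤ M * ‖s‖ ^ 2 := by
    have h1 : y - (1 - s) = (y - (1 + k * e)) + k * (e + s / k) := by field_simp; ring
    rw [h1]
    calc _ ≤ D * ‖e‖ ^ 2 + k * (C * ‖s‖ ^ 2) := by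
          refine (norm_add_le _ _).trans (add_le_add (hexp e (heK.trans hsK)) ?_)
          rw [norm_mul, Complex.norm_natCast]
          gcongr
      _ ≤ D * (K * ‖s‖) ^ 2 + k * (C * ‖s‖ ^ 2) := by gcongr
      _ = M * ‖s‖ ^ 2 := by rw [hM]; ring
  have hyn : 1 / 2 ≤ ‖y‖ := by
    have h1 : ‖(1 : ℂ)‖ ≤ ‖y‖ + ‖y - (1 - s)‖ + ‖s‖ := by
      calc ‖(1 : ℂ)‖ = ‖y - (y - (1 - s)) + s‖ := by congr 1; ring
        _ ≤ _ := (norm_add_le _ _).trans (by gcongr; exact norm_sub_le _ _)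
    have h2 : M * ‖s‖ ^ 2 ≤ M * ‖s‖ := by
      gcongr; exact pow_le_of_le_one (norm_nonneg _) hs1 (by norm_num)
    rw [norm_one] at h1
    nlinarith
  have hy0 : y ≠ 0 := norm_pos_iff.1 (by linarith)
  have hwk : w' ^ k = s * y := by rw [hwe, mul_pow]
  refine ⟨?_, ?_, ?_⟩
  · rintro rfl
    rw [zero_pow (by omega)] at hwk
    exact mul_ne_zero hs0 hy0 hwk.symm
  · rw [← hsn]
    refine heK.trans ?_
    gcongr
    linarith
  · rw [hwk, ← hsn]
    -- The terms of order 0 and 1 in `s` cancel in the numerator, which leaves `O(|s|^2)` over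
    -- `|s|`.
    have h1 : (s * y)⁻¹ - (s⁻¹ + 1) = (s ^ 2 - (y - (1 - s)) * (1 + s)) / (s * y) := by
      field_simp; ring
    have h2 : ‖1 + s‖ ≤ 2 := by
      refine (norm_add_le _ _).trans ?_
      rw [norm_one]; linarith
    have h3 : ‖s ^ 2 - (y - (1 - s)) * (1 + s)‖ ≤ (1 + 2 * M) * ‖s‖ ^ 2 := by
      calc _ ≤ ‖s‖ ^ 2 + M * ‖s‖ ^ 2 * 2 := by
            refine (norm_sub_le _ _).trans ?_
            rw [norm_pow, norm_mul]
            gcongr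
        _ = _ := by ring
    rw [h1, norm_div, norm_mul, div_le_iff₀ (by positivity)]
    calc _ ≤ (1 + 2 * M) * ‖s‖ ^ 2 := h3
      _ = 2 * (1 + 2 * M) * ‖s‖ * (‖s‖ * (1 / 2)) := by ring
      _ ≤ (2 * (1 + 2 * M) + K) * ‖s‖ * (‖s‖ * ‖y‖) := by
          gcongr
          linarith

/-! ### Sectors -/

/-- A linear inequality is easier to perturb than an angle. Either side forces `0 < x.re`, where the
argument is read off through the monotone `tan`. -/
lemma abs_arg_lt_iff_abs_im_lt {φ : ℝ} (hφ0 : 0 < φ) (hφ : φ < Real.pi / 2) (x : ℂ) (hx : x ≠ 0) :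
    |x.arg| < φ ↔ |x.im| < Real.tan φ * x.re := by
  have hT : 0 < Real.tan φ := Real.tan_pos_of_pos_of_lt_pi_div_two hφ0 hφ
  have key : 0 < x.re → (|x.arg| < φ ↔ |x.im| < Real.tan φ * x.re) := fun hre => by
    have harg : |x.arg| < Real.pi / 2 := Complex.abs_arg_lt_pi_div_two_iff.2 (Or.inl hre)
    have him : x.im = Real.tan x.arg * x.re := by
      rw [Complex.tan_arg]; field_simp
    have hmem : x.arg ∈ Set.Ioo (-(Real.pi / 2)) (Real.pi / 2) := abs_lt.1 harg
    have hmem' : φ ∈ Set.Ioo (-(Real.pi / 2)) (Real.pi / 2) := ⟨by linarith, hφ⟩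
    have hmem'' : -φ ∈ Set.Ioo (-(Real.pi / 2)) (Real.pi / 2) := ⟨by linarith, by linarith⟩
    rw [him, abs_mul, abs_of_pos hre, mul_lt_mul_iff_left₀ hre, abs_lt, abs_lt, ← Real.tan_neg,
      Real.strictMonoOn_tan.lt_iff_lt hmem hmem', Real.strictMonoOn_tan.lt_iff_lt hmem'' hmem]
  refine ⟨fun h => ?_, fun h => ?_⟩
  · have hre : 0 < x.re :=
      (Complex.abs_arg_lt_pi_div_two_iff.1 (h.trans hφ)).resolve_right hx
    exact (key hre).1 h
  · have hre : 0 < x.re := pos_of_mul_pos_right ((abs_nonneg _).trans_lt h) hT.le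
    exact (key hre).2 h

lemma arg_pow_eq_of_abs_lt {k : ℕ} (hk : 1 ≤ k) {w : ℂ} (hw : |w.arg| < Real.pi / k) :
    (w ^ k).arg = k * w.arg := by
  have hk0 : (0 : ℝ) < k := by exact_mod_cast hk
  have h := congrArg Real.Angle.toReal (Complex.arg_pow_coe_angle w k)
  rw [lt_div_iff₀ hk0] at hw
  have h2 : |(k : ℝ) * w.arg| < Real.pi := by rw [abs_mul, abs_of_pos hk0]; linarith
  rw [abs_lt] at h2
  rw [Real.Angle.toReal_coe_eq_self_iff.2 (Complex.arg_mem_Ioc _), ← Real.Angle.coe_nsmul,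
    Real.Angle.toReal_coe_eq_self_iff.2] at h
  · rw [h, nsmul_eq_mul]
  · rw [nsmul_eq_mul]
    exact ⟨h2.1, h2.2.le⟩

/-- In the sector `|arg w| < π / k`, the narrower sector `|arg w| < θ` is described by a cone in the
coordinate `(w ^ k)⁻¹`. -/
lemma abs_arg_lt_iff_inv_pow {k : ℕ} (hk : 1 ≤ k) {θ : ℝ} (hθ : 0 < θ)
    (hθk : θ < Real.pi / (2 * k)) {w : ℂ} (hw0 : w ≠ 0) (hw : |w.arg| < Real.pi / k) :
    |w.arg| < θ ↔ |((w ^ k)⁻¹).im| < Real.tan (k * θ) * ((w ^ k)⁻¹).re := by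
  have hk0 : (0 : ℝ) < k := by exact_mod_cast hk
  have hpow := arg_pow_eq_of_abs_lt hk hw
  have hne : (w ^ k).arg ≠ Real.pi := by
    rw [hpow]
    have h2 : |w.arg| * k < Real.pi := (lt_div_iff₀ hk0).1 hw
    have h3 := le_abs_self w.arg
    nlinarith
  rw [← abs_arg_lt_iff_abs_im_lt (by positivity) (by
      rw [lt_div_iff₀ (by positivity)] at hθk; linarith) _ (inv_ne_zero (pow_ne_zero _ hw0)),
    Complex.arg_inv, if_neg hne, abs_neg, hpow, abs_mul, abs_of_pos hk0,
    mul_lt_mul_iff_right₀ hk0]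

lemma exists_sector_step {k : ℕ} (hk : 1 ≤ k) {C θ : ℝ} (hC : 0 ≤ C) (hθ : 0 < θ)
    (hθk : θ < Real.pi / (2 * k)) :
    ∃ r : ℝ, 0 < r ∧ ∀ w w' : ℂ, w ≠ 0 → ‖w‖ < r → |w.arg| < θ →
      ‖w' - w * (1 - w ^ k / k)‖ ≤ C * ‖w‖ ^ (2 * k + 1) →
      w' ≠ 0 ∧ |w'.arg| < θ ∧ ((w ^ k)⁻¹).re + 1 / 2 ≤ ((w' ^ k)⁻¹).re := by
  have hk0 : (0 : ℝ) < k := by exact_mod_cast hk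
  obtain ⟨L, hL, r₁, hr₁, hstep⟩ := exists_norm_inv_pow_sub_le hk hC
  have hpi := Real.pi_pos
  have harg : ∀ᶠ x : ℂ in 𝓝 1, |x.arg| < Real.pi / (2 * k) := by
    have h1 : ContinuousAt (fun x : ℂ => |x.arg|) 1 :=
      (Complex.continuousAt_arg Complex.one_mem_slitPlane).abs
    refine h1.eventually_lt continuousAt_const ?_
    simp only [Complex.arg_one, abs_zero]
    positivity
  obtain ⟨ε, hε, harg⟩ := Metric.eventually_nhds_iff.1 harg
  set T := Real.tan (k * θ) with hT
  have hT0 : 0 < T := Real.tan_pos_of_pos_of_lt_pi_div_two (by positivity) (by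
      rw [lt_div_iff₀ (by positivity)] at hθk; linarith)
  -- Bounds on the error: `ε / 2` keeps `w' / w` near 1, `1 / 2` leaves half of the unit
  -- translation, and `η ≤ T(1 - η)` keeps the image in the cone of slope `T`.
  set η : ℝ := min (min (ε / 2) (1 / 2)) (T / (1 + T)) with hη
  have hη0 : 0 < η := by positivity
  have hηε : η ≤ ε / 2 := (min_le_left _ _).trans (min_le_left _ _)
  have hη2 : η ≤ 1 / 2 := (min_le_left _ _).trans (min_le_right _ _)
  have hηT : η * (1 + T) ≤ T := by
    rw [← le_div_iff₀ (by positivity)]; exact min_le_right _ _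
  refine ⟨min (min r₁ 1) (η / (1 + L)), by positivity, fun w w' hw hwr hwθ hww => ?_⟩
  have hr1 : ‖w‖ < r₁ := hwr.trans_le ((min_le_left _ _).trans (min_le_left _ _))
  have hw1 : ‖w‖ ≤ 1 := hwr.le.trans ((min_le_left _ _).trans (min_le_right _ _))
  have hwη : (1 + L) * ‖w‖ ≤ η := by
    have := hwr.le.trans (min_le_right _ _)
    rw [le_div_iff₀ (by positivity)] at this
    linarith
  obtain ⟨h0, hquot, hinv⟩ := hstep w w' hw hr1 hww
  have hLw : L * ‖w‖ ^ k ≤ η := by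
    have h1 : ‖w‖ ^ k ≤ ‖w‖ := pow_le_of_le_one (norm_nonneg _) hw1 (by omega)
    have h2 : L * ‖w‖ ^ k ≤ L * ‖w‖ := by gcongr
    nlinarith [norm_nonneg w]
  have hdiv : |(w' / w).arg| < Real.pi / (2 * k) := by
    apply harg
    rw [dist_eq_norm]
    linarith
  have hhalf : Real.pi / (2 * k) + Real.pi / (2 * k) = Real.pi / k := by field_simp; ring
  have hpik : Real.pi / k ≤ Real.pi := div_le_self hpi.le (by exact_mod_cast hk)
  -- The cone for `w' ^ k` determines `w'` only up to `k`-th roots of unity; this bound selects the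
  -- right branch.
  have hargw' : |w'.arg| < Real.pi / k := by
    have h1 : |w.arg + (w' / w).arg| < Real.pi / k := by
      refine (abs_add_le _ _).trans_lt ?_
      linarith
    have h2 := abs_lt.1 (h1.trans_le hpik)
    have h3 := Complex.arg_mul hw (div_ne_zero h0 hw) ⟨h2.1, h2.2.le⟩
    rw [mul_div_cancel₀ _ hw] at h3
    rw [h3]; exact h1
  have hargw : |w.arg| < Real.pi / k := by
    have : 0 < Real.pi / (2 * k) := by positivity
    linarith
  set δ : ℂ := (w' ^ k)⁻¹ - ((w ^ k)⁻¹ + 1) with hδ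
  have hδη : ‖δ‖ ≤ η := hinv.trans hLw
  have hU : (w' ^ k)⁻¹ = (w ^ k)⁻¹ + 1 + δ := by rw [hδ]; ring
  have hδre : -η ≤ δ.re := (abs_le.1 ((Complex.abs_re_le_norm δ).trans hδη)).1
  have hδim : |δ.im| ≤ η := (Complex.abs_im_le_norm δ).trans hδη
  refine ⟨h0, ?_, ?_⟩
  · rw [abs_arg_lt_iff_inv_pow hk hθ hθk h0 hargw', ← hT, hU]
    rw [abs_arg_lt_iff_inv_pow hk hθ hθk hw hargw, ← hT] at hwθ
    simp only [Complex.add_im, Complex.add_re, Complex.one_im, Complex.one_re, add_zero]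
    calc |((w ^ k)⁻¹).im + δ.im| ≤ |((w ^ k)⁻¹).im| + |δ.im| := abs_add_le _ _
      _ < T * ((w ^ k)⁻¹).re + η := add_lt_add_of_lt_of_le hwθ hδim
      _ ≤ T * (((w ^ k)⁻¹).re + 1 + δ.re) := by nlinarith
  · rw [hU]
    simp only [Complex.add_re, Complex.one_re]
    linarith

/-- Inversion sends this disc, whose boundary passes through 0, to a half-plane. At `s = 0` both
sides fail, as `0⁻¹ = 0`. -/
lemma norm_sub_lt_iff_lt_re_inv {R : ℝ} (hR : 0 < R) (s : ℂ) :
    ‖s - ((1 / (2 * R) : ℝ) : ℂ)‖ < 1 / (2 * R) ↔ R < (s⁻¹).re := by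
  by_cases hs : s = 0
  · subst hs
    simp only [zero_sub, norm_neg, Complex.norm_real, Real.norm_eq_abs, inv_zero, Complex.zero_re]
    rw [abs_of_pos (by positivity)]
    simp [hR.le]
  have hns : 0 < Complex.normSq s := Complex.normSq_pos.2 hs
  rw [← sq_lt_sq₀ (norm_nonneg _) (by positivity), ← Complex.normSq_eq_norm_sq,
    Complex.inv_re, lt_div_iff₀ hns]
  have h1 : Complex.normSq (s - ((1 / (2 * R) : ℝ) : ℂ))
      = Complex.normSq s - s.re / R + (1 / (2 * R)) ^ 2 := by
    rw [Complex.normSq_apply, Complex.normSq_apply, Complex.sub_re, Complex.sub_im,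
      Complex.ofReal_re, Complex.ofReal_im]
    field_simp; ring
  rw [h1]
  have h2 : R * (s.re / R) = s.re := by field_simp
  constructor
  · intro h
    nlinarith
  · intro h
    by_contra hcon
    push Not at hcon
    have : s.re / R ≤ Complex.normSq s := by linarith
    nlinarith

/-! ### The condition on the moduli of the coordinates -/

/-- Combines `log x ≥ 1 - 1/x` with `exp x ≥ 1 + x`. -/
lemma one_sub_div_le_rpow {t β : ℝ} (hβ : 0 ≤ β) (ht : t < 1) :
    1 - β * (t / (1 - t)) ≤ (1 - t) ^ β := by
  have h1 : 0 < 1 - t := by linarith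
  have h2 : -(t / (1 - t)) ≤ Real.log (1 - t) := by
    refine le_trans (le_of_eq ?_) (Real.one_sub_inv_le_log_of_pos h1)
    field_simp; ring
  rw [Real.rpow_def_of_pos h1]
  have h3 := Real.add_one_le_exp (Real.log (1 - t) * β)
  nlinarith

lemma norm_one_sub_le (x : ℂ) : ‖1 - x‖ ≤ 1 - x.re + ‖x‖ ^ 2 := by
  have h0 : x.re ≤ ‖x‖ := Complex.re_le_norm x
  have h1 : ‖1 - x‖ ^ 2 = 1 - 2 * x.re + ‖x‖ ^ 2 := by
    rw [← Complex.normSq_eq_norm_sq, ← Complex.normSq_eq_norm_sq, Complex.normSq_apply,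
      Complex.normSq_apply]
    simp only [Complex.sub_re, Complex.sub_im, Complex.one_re, Complex.one_im]
    ring
  have h2 : 0 ≤ 1 - x.re + ‖x‖ ^ 2 := by nlinarith [sq_nonneg (‖x‖ - 1)]
  refine le_of_sq_le_sq ?_ h2
  rw [h1]
  nlinarith [sq_nonneg (x.re - ‖x‖ ^ 2), sq_nonneg (1 - x.re), sq_nonneg (x.re),
    sq_nonneg (‖x‖ ^ 2)]

/-- Put `ρ = Re(w^k)`. In the sector `|w^k| ≤ (1 + T)ρ`, so every error is `O(ρ^2)`; after division
by `|w|^β` the linear terms `-ρ/(kd)` and `-βρ/k` decide. -/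
lemma exists_norm_add_lt_rpow {k d : ℕ} (hk : 1 ≤ k) (hd : 1 ≤ d) {C θ β : ℝ} (hC : 0 ≤ C)
    (hθ : 0 < θ) (hθk : θ < Real.pi / (2 * k)) (hβ : 0 < β) (hβd : β < 1 / d) :
    ∃ r : ℝ, 0 < r ∧ ∀ w w' : ℂ, w ≠ 0 → ‖w‖ < r → |w.arg| < θ →
      ‖w' - w * (1 - w ^ k / k)‖ ≤ C * ‖w‖ ^ (2 * k + 1) →
      ‖w‖ ^ β * (‖1 - w ^ k / (k * d)‖ + C * ‖w‖ ^ (2 * k)) < ‖w'‖ ^ β := by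
  have hk0 : (0 : ℝ) < k := by exact_mod_cast hk
  have hd0 : (0 : ℝ) < d := by exact_mod_cast hd
  have hk1 : (1 : ℝ) ≤ k := by exact_mod_cast hk
  have hd1 : (1 : ℝ) ≤ d := by exact_mod_cast hd
  have hφ : k * θ < Real.pi / 2 := by
    rw [lt_div_iff₀ (by positivity)] at hθk; linarith
  set T := Real.tan (k * θ) with hT
  have hT0 : 0 < T := Real.tan_pos_of_pos_of_lt_pi_div_two (by positivity) hφ
  set B : ℝ := (1 + T) ^ 2 with hB
  have hev1 : ∀ᶠ ρ : ℝ in 𝓝 0, ρ * (1 / k + C * B * ρ) < 1 := by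
    have h1 : ContinuousAt (fun ρ : ℝ => ρ * (1 / k + C * B * ρ)) 0 := by fun_prop
    exact h1.eventually_lt continuousAt_const (by simp)
  -- The required comparison divided by `ρ`; at `ρ = 0` it reads `β/k < 1/(kd)`.
  have hev2 : ∀ᶠ ρ : ℝ in 𝓝 0,
      β * ((1 / k + C * B * ρ) / (1 - ρ * (1 / k + C * B * ρ))) < 1 / (k * d) - (1 + C) * B * ρ := by
    have h1 : ContinuousAt
        (fun ρ : ℝ => β * ((1 / k + C * B * ρ) / (1 - ρ * (1 / k + C * B * ρ)))) 0 := by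
      refine continuousAt_const.mul (ContinuousAt.div ?_ ?_ (by simp))
      · fun_prop
      · fun_prop
    refine h1.eventually_lt (by fun_prop) ?_
    simp only [mul_zero, add_zero, zero_mul, sub_zero, div_one]
    rw [lt_div_iff₀ hd0] at hβd
    rw [mul_one_div, div_lt_div_iff₀ hk0 (by positivity)]
    nlinarith
  obtain ⟨ε, hε, hev⟩ := Metric.eventually_nhds_iff.1 (hev1.and hev2)
  refine ⟨min ε 1, by positivity, fun w w' hw hwr hwθ hww => ?_⟩
  have hwn : 0 < ‖w‖ := norm_pos_iff.2 hw
  have hw1 : ‖w‖ ≤ 1 := hwr.le.trans (min_le_right _ _)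
  set s : ℂ := w ^ k with hs
  have hsn : ‖s‖ = ‖w‖ ^ k := norm_pow _ _
  have hs0 : s ≠ 0 := pow_ne_zero _ hw
  have hsw : ‖s‖ ≤ ‖w‖ := by
    rw [hsn]; exact pow_le_of_le_one hwn.le hw1 (by omega)
  set ρ := s.re with hρ
  have harg : |s.im| < T * ρ := by
    have h1 : |w.arg| < Real.pi / k := by
      refine hwθ.trans (hθk.trans_le ?_)
      gcongr
      linarith
    rw [hT, hρ, ← abs_arg_lt_iff_abs_im_lt (by positivity) hφ s hs0, hs,
      arg_pow_eq_of_abs_lt hk h1, abs_mul, abs_of_pos hk0]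
    gcongr
  have hρ0 : 0 < ρ := pos_of_mul_pos_right ((abs_nonneg _).trans_lt harg) hT0.le
  have hsρ : ‖s‖ ^ 2 ≤ B * ρ ^ 2 := by
    rw [hB, ← mul_pow]
    gcongr
    refine (Complex.norm_le_abs_re_add_abs_im s).trans ?_
    rw [← hρ, abs_of_pos hρ0]
    linarith
  have hρε : dist ρ 0 < ε := by
    rw [Real.dist_0_eq_abs]
    exact ((Complex.abs_re_le_norm s).trans hsw).trans_lt (hwr.trans_le (min_le_left _ _))
  obtain ⟨ht1, ht2⟩ := hev hρε
  set t := ρ * (1 / k + C * B * ρ) with ht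
  have hwk : ‖w‖ ^ (2 * k) = ‖s‖ ^ 2 := by rw [hsn]; ring
  have hleft : ‖1 - s / (k * d)‖ ≤ 1 - ρ / (k * d) + B * ρ ^ 2 := by
    have h1 := norm_one_sub_le (s / (k * d))
    have h2 : (s / (k * d)).re = ρ / (k * d) := by
      have : s / ((k : ℂ) * d) = s / ((k * d : ℝ) : ℂ) := by push_cast; rfl
      rw [this, Complex.div_ofReal_re]
    have h3 : ‖s / (k * d)‖ ≤ ‖s‖ := by
      rw [norm_div, norm_mul, Complex.norm_natCast, Complex.norm_natCast]
      exact div_le_self (norm_nonneg _) (by nlinarith)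
    have h4 : ‖s / (k * d)‖ ^ 2 ≤ ‖s‖ ^ 2 := by gcongr
    rw [h2] at h1
    linarith
  have hright : ‖w‖ * (1 - t) ≤ ‖w'‖ := by
    have h1 : ‖w‖ * (1 - ρ / k) ≤ ‖w * (1 - s / k)‖ := by
      rw [norm_mul]
      gcongr
      have h2 : (1 - s / k).re = 1 - ρ / k := by
        have : s / (k : ℂ) = s / ((k : ℝ) : ℂ) := by push_cast; rfl
        rw [Complex.sub_re, Complex.one_re, this, Complex.div_ofReal_re]
      rw [← h2]
      exact Complex.re_le_norm _
    have h3 : ‖w * (1 - s / k)‖ ≤ ‖w'‖ + ‖w' - w * (1 - s / k)‖ := by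
      calc _ = ‖w' - (w' - w * (1 - s / k))‖ := by congr 1; ring
        _ ≤ _ := norm_sub_le _ _
    have h4 : C * ‖w‖ ^ (2 * k + 1) ≤ ‖w‖ * (C * (B * ρ ^ 2)) := by
      rw [pow_succ, hwk, mul_comm ‖w‖, ← mul_assoc]
      gcongr
    have h5 : ‖w‖ * (1 - t) = ‖w‖ * (1 - ρ / k) - ‖w‖ * (C * (B * ρ ^ 2)) := by
      rw [ht]; ring
    linarith
  calc ‖w‖ ^ β * (‖1 - s / (k * d)‖ + C * ‖w‖ ^ (2 * k))
      ≤ ‖w‖ ^ β * (1 - ρ / (k * d) + B * ρ ^ 2 + C * (B * ρ ^ 2)) := by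
        rw [hwk]; gcongr
    _ < ‖w‖ ^ β * (1 - β * (t / (1 - t))) := by
        have h1 : 0 < ‖w‖ ^ β := Real.rpow_pos_of_pos hwn _
        refine mul_lt_mul_of_pos_left ?_ h1
        have h2 := mul_lt_mul_of_pos_left ht2 hρ0
        have h3 : ρ * (β * ((1 / k + C * B * ρ) / (1 - t))) = β * (t / (1 - t)) := by
          conv_rhs => rw [ht]
          rw [← ht]; ring
        have h4 : ρ * (1 / (k * d) - (1 + C) * B * ρ)
            = ρ / (k * d) - B * ρ ^ 2 - C * (B * ρ ^ 2) := by ring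
        rw [h3, h4] at h2
        linarith
    _ ≤ ‖w‖ ^ β * (1 - t) ^ β := by
        gcongr
        exact one_sub_div_le_rpow hβ.le ht1
    _ = (‖w‖ * (1 - t)) ^ β := (Real.mul_rpow hwn.le (by linarith)).symm
    _ ≤ ‖w'‖ ^ β := by
        have : 0 ≤ ‖w‖ * (1 - t) := mul_nonneg hwn.le (by linarith)
        gcongr

/-! ### Resonances -/

lemma OneResonant.prod_eq_one {d : ℕ} (hd : 1 ≤ d) {lam : Fin d → ℂ} (hlam : ∀ j, ‖lam j‖ = 1)
    (hres : OneResonant (fun _ => 1) lam) : ∏ i, lam i = 1 := by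
  have h := (hres ⟨0, hd⟩ ((1 : ℕ) • (fun _ => 1) + Pi.single ⟨0, hd⟩ 1)).2 ⟨1, rfl⟩
  have h0 : lam ⟨0, hd⟩ ≠ 0 := norm_pos_iff.1 (by rw [hlam]; exact one_pos)
  have h1 : ∏ i, lam i ^ ((1 : ℕ) • (fun _ => 1) + Pi.single ⟨0, hd⟩ 1 : Fin d → ℕ) i
      = (∏ i, lam i) * lam ⟨0, hd⟩ := by
    simp only [one_smul, Pi.add_apply, pow_add, pow_one, Finset.prod_mul_distrib]
    congr 1
    rw [Finset.prod_eq_single ⟨0, hd⟩]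
    · simp
    · intro b _ hb
      simp [Pi.single_eq_of_ne hb]
    · simp
  rw [h1] at h
  exact (mul_eq_right₀ h0).1 h.symm

/-- An equality `lam i = lam j` is a resonance with `m = e_j`; for `i ≠ j` its `i`-th entry would
give `0 = q + 1`. -/
lemma OneResonant.injective {d : ℕ} {lam : Fin d → ℂ}
    (hres : OneResonant (fun _ => 1) lam) : Function.Injective lam := by
  intro i j hij
  by_contra hne
  have h : lam i = ∏ a, lam a ^ (Pi.single j 1 : Fin d → ℕ) a := by
    rw [Finset.prod_eq_single j]
    · simp [hij]
    · intro b _ hb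
      simp [Pi.single_eq_of_ne hb]
    · simp
  obtain ⟨q, hq⟩ := (hres i _).1 h
  have := congrFun hq i
  simp [Pi.single_eq_of_ne hne] at this

/-! ### Estimates for `F` -/

lemma norm_le_of_apply_le {d : ℕ} (hd : 1 ≤ d) (z : EuclideanSpace ℂ (Fin d)) {a : ℝ} (ha : 0 ≤ a)
    (hz : ∀ j, ‖z j‖ ≤ a) : ‖z‖ ≤ d * a := by
  have hd1 : (1 : ℝ) ≤ d := by exact_mod_cast hd
  refine le_of_sq_le_sq ?_ (by positivity)
  rw [EuclideanSpace.norm_sq_eq]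
  calc ∑ j, ‖z j‖ ^ 2 ≤ ∑ _j : Fin d, a ^ 2 := by
        gcongr with j; exact hz j
    _ = d * a ^ 2 := by simp
    _ ≤ (d * a) ^ 2 := by nlinarith [sq_nonneg a]

lemma coordProd_normalForm {d k : ℕ} {lam : Fin d → ℂ} (hprod : ∏ i, lam i = 1)
    (z : EuclideanSpace ℂ (Fin d)) :
    coordProd (normalForm k lam z) = coordProd z * (1 - coordProd z ^ k / (k * d)) ^ d := by
  have h : coordProd (normalForm k lam z)
      = ∏ j, lam j * z j * (1 - coordProd z ^ k / (k * d)) := rfl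
  rw [h, Finset.prod_mul_distrib, Finset.prod_mul_distrib, hprod, one_mul, Finset.prod_const,
    Finset.card_univ, Fintype.card_fin]
  rfl

lemma rpow_pow_le_pow {x β : ℝ} (hx0 : 0 < x) (hx1 : x ≤ 1) {m n : ℕ} (h : (n : ℝ) ≤ β * m) :
    (x ^ β) ^ m ≤ x ^ n := by
  rw [← Real.rpow_natCast (x ^ β) m, ← Real.rpow_mul hx0.le, ← Real.rpow_natCast x n]
  exact Real.rpow_le_rpow_of_exponent_ge hx0 hx1 h

/-- The third estimate drives the dynamics of `u^(-k)`. The second keeps the `d`-th power because it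
matches the coordinate factor exactly, as the asymptotics of orbits require. -/
lemma exists_local_estimates {d k l : ℕ} (hd : 1 ≤ d) (hk : 1 ≤ k) (hl : 1 ≤ l)
    {lam : Fin d → ℂ} (hlam : ∀ j, ‖lam j‖ = 1) (hprod : ∏ i, lam i = 1)
    {F : EuclideanSpace ℂ (Fin d) → EuclideanSpace ℂ (Fin d)}
    (hFN : (fun z => F z - normalForm k lam z) =O[𝓝 0] fun z => ‖z‖ ^ l)
    {β : ℝ} (hβ : 0 < β) (hβl : 2 * (k : ℝ) + 1 < β * ((l : ℝ) + d - 1)) :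
    ∃ C : ℝ, 0 ≤ C ∧ ∃ r : ℝ, 0 < r ∧ ∀ z ∈ regionW d β, coordProd z ≠ 0 → ‖coordProd z‖ < r →
      (∀ j, ‖F z j - lam j * z j * (1 - coordProd z ^ k / (k * d))‖
        ≤ C * (‖coordProd z‖ ^ β) ^ l) ∧
      ‖coordProd (F z) - coordProd z * (1 - coordProd z ^ k / (k * d)) ^ d‖
        ≤ C * ‖coordProd z‖ ^ (2 * k + 1) ∧
      ‖coordProd (F z) - coordProd z * (1 - coordProd z ^ k / k)‖
        ≤ C * ‖coordProd z‖ ^ (2 * k + 1) := by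
  have hk1 : (1 : ℝ) ≤ k := by exact_mod_cast hk
  have hd1 : (1 : ℝ) ≤ d := by exact_mod_cast hd
  have hk0 : (k : ℂ) ≠ 0 := by exact_mod_cast (by omega : k ≠ 0)
  have hd0 : (d : ℂ) ≠ 0 := by exact_mod_cast (by omega : d ≠ 0)
  obtain ⟨C₀, hC₀, hO⟩ := hFN.exists_nonneg
  obtain ⟨ε, hε, hO⟩ := Metric.eventually_nhds_iff.1 hO.bound
  obtain ⟨D, hD, hexp⟩ := exists_norm_one_add_pow_sub_le d
  set C₁ : ℝ := C₀ * d ^ l with hC₁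
  set C₂ : ℝ := d * (2 + C₁) ^ d * C₁ with hC₂
  have hsmall : ∀ᶠ x : ℝ in 𝓝 0, d * x ^ β < ε := by
    have h1 : ContinuousAt (fun x : ℝ => d * x ^ β) 0 :=
      continuousAt_const.mul (Real.continuousAt_rpow_const _ _ (Or.inr hβ.le))
    refine h1.eventually_lt continuousAt_const ?_
    simpa [Real.zero_rpow hβ.ne'] using hε
  obtain ⟨r, hr, hsmall⟩ := Metric.eventually_nhds_iff.1 hsmall
  refine ⟨C₁ + C₂ + D, by positivity, min r 1, by positivity, fun z hz hu0 hur => ?_⟩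
  set u := coordProd z with hu
  set x := ‖u‖ with hx
  have hx0 : 0 < x := norm_pos_iff.2 hu0
  have hx1 : x ≤ 1 := hur.le.trans (min_le_right _ _)
  set a := x ^ β with ha
  have ha0 : 0 < a := Real.rpow_pos_of_pos hx0 _
  have ha1 : a ≤ 1 := Real.rpow_le_one hx0.le hx1 hβ.le
  have hzn : ‖z‖ ≤ d * a := norm_le_of_apply_le hd z ha0.le fun j => (hz j).le
  have hzε : dist z 0 < ε := by
    rw [dist_zero_right]
    refine hzn.trans_lt (hsmall ?_)
    rw [Real.dist_0_eq_abs, abs_of_pos hx0]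
    exact hur.trans_le (min_le_left _ _)
  have hG : ‖F z - normalForm k lam z‖ ≤ C₁ * a ^ l := by
    refine (hO hzε).trans ?_
    rw [norm_pow, norm_norm, hC₁, mul_assoc, ← mul_pow]
    gcongr
  have hGj : ∀ j, ‖F z j - normalForm k lam z j‖ ≤ C₁ * a ^ l := fun j =>
    (PiLp.norm_apply_le (F z - normalForm k lam z) j).trans hG
  have hsx : ‖u ^ k / (k * d)‖ ≤ x ^ k := by
    rw [norm_div, norm_mul, Complex.norm_natCast, Complex.norm_natCast, norm_pow]
    exact div_le_self (by positivity) (by nlinarith)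
  have hxk : x ^ k ≤ 1 := pow_le_one₀ hx0.le hx1
  have hNj : ∀ j, ‖normalForm k lam z j‖ ≤ 2 * a := fun j => by
    change ‖lam j * z j * (1 - u ^ k / (k * d))‖ ≤ 2 * a
    rw [norm_mul, norm_mul, hlam, one_mul, mul_comm 2]
    refine mul_le_mul (hz j).le ?_ (norm_nonneg _) ha0.le
    refine (norm_sub_le _ _).trans ?_
    rw [norm_one]; linarith
  have hal : a ^ l ≤ a := pow_le_of_le_one ha0.le ha1 (by omega)
  have hC₁0 : 0 ≤ C₁ := by positivity
  have hFj : ∀ j, ‖F z j‖ ≤ (2 + C₁) * a := fun j => by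
    calc ‖F z j‖ = ‖normalForm k lam z j + (F z j - normalForm k lam z j)‖ := by
          congr 1; ring
      _ ≤ 2 * a + C₁ * a ^ l := (norm_add_le _ _).trans (add_le_add (hNj j) (hGj j))
      _ ≤ 2 * a + C₁ * a := by gcongr
      _ = _ := by ring
  have hpd : ‖coordProd (F z) - u * (1 - u ^ k / (k * d)) ^ d‖ ≤ C₂ * x ^ (2 * k + 1) := by
    have h1 := norm_prod_sub_prod_mul_le Finset.univ (fun j => F z j)
      (fun j => normalForm k lam z j) (A := (2 + C₁) * a) (G := C₁ * a ^ l) (by positivity)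
      (fun j _ => hFj j)
      (fun j _ => (hNj j).trans (by gcongr; linarith)) (fun j _ => hGj j)
    have h2 : ∏ j, normalForm k lam z j = u * (1 - u ^ k / (k * d)) ^ d :=
      coordProd_normalForm hprod z
    rw [h2, Finset.card_univ, Fintype.card_fin] at h1
    change ‖coordProd (F z) - _‖ * _ ≤ _ at h1
    -- Exchanging one of `d` factors of size `a` for an error `a^l` costs `a^(l+d-1)`.
    have h3 : a ^ (l + d - 1) ≤ x ^ (2 * k + 1) := by
      refine rpow_pow_le_pow hx0 hx1 ?_
      rw [Nat.cast_sub (by omega)]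
      push_cast
      exact hβl.le
    have h4 : d * ((2 + C₁) * a) ^ d * (C₁ * a ^ l) = C₂ * a ^ (l + d - 1) * a := by
      have : a ^ (l + d - 1) * a = a ^ d * a ^ l := by
        rw [← pow_succ, ← pow_add]; congr 1; omega
      rw [mul_assoc C₂, this, hC₂, mul_pow]; ring
    rw [h4, ← mul_assoc] at h1
    have h5 := le_of_mul_le_mul_right h1 ha0
    have h6 : ‖coordProd (F z) - u * (1 - u ^ k / (k * d)) ^ d‖
        ≤ ‖coordProd (F z) - u * (1 - u ^ k / (k * d)) ^ d‖ * (2 + C₁) :=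
      le_mul_of_one_le_right (norm_nonneg _) (by linarith)
    refine h6.trans (h5.trans ?_)
    gcongr
  have hx2 : 0 ≤ x ^ (2 * k + 1) := by positivity
  have hC₂0 : 0 ≤ C₂ := by positivity
  refine ⟨fun j => (hGj j).trans ?_, hpd.trans ?_, ?_⟩
  · gcongr
    linarith
  · gcongr
    linarith
  · have h1 := hexp (-(u ^ k / (k * d))) (by rw [norm_neg]; exact hsx.trans hxk)
    rw [norm_neg] at h1
    have h2 : (1 - u ^ k / (k * d)) ^ d - (1 - u ^ k / k)
        = (1 + -(u ^ k / (k * d))) ^ d - (1 + d * -(u ^ k / (k * d))) := by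
      field_simp; ring
    have h3 : ‖u * ((1 - u ^ k / (k * d)) ^ d - (1 - u ^ k / k))‖ ≤ D * x ^ (2 * k + 1) := by
      rw [norm_mul, h2]
      calc _ ≤ x * (D * (x ^ k) ^ 2) := by
            refine mul_le_mul_of_nonneg_left (h1.trans ?_) hx0.le
            gcongr
        _ = _ := by ring
    calc _ = ‖(coordProd (F z) - u * (1 - u ^ k / (k * d)) ^ d)
            + u * ((1 - u ^ k / (k * d)) ^ d - (1 - u ^ k / k))‖ := by congr 1; ring
      _ ≤ C₂ * x ^ (2 * k + 1) + D * x ^ (2 * k + 1) := (norm_add_le _ _).trans (add_le_add hpd h3)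
      _ ≤ _ := by nlinarith

/-! ### The rotation to the attracting direction -/

/-- Since `u ↦ u(1 - u^k/k)` commutes with multiplication by `k`-th roots of unity, every direction
reduces to `h = 0`. -/
lemma rotation_pow {k : ℕ} (hk : 1 ≤ k) (h : ℕ) :
    Complex.exp (-(2 * Real.pi * h / k * Complex.I)) ^ k = 1 := by
  have hk0 : (k : ℂ) ≠ 0 := by exact_mod_cast (by omega : k ≠ 0)
  rw [← Complex.exp_nat_mul]
  have : (k : ℂ) * -(2 * Real.pi * h / k * Complex.I) = ((-h : ℤ) : ℂ) * (2 * Real.pi * Complex.I) := by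
    push_cast; field_simp
  rw [this, Complex.exp_int_mul_two_pi_mul_I]

lemma norm_rotation (k h : ℕ) : ‖Complex.exp (-(2 * Real.pi * h / k * Complex.I))‖ = 1 := by
  have : -(2 * Real.pi * h / k * Complex.I) = ((-(2 * Real.pi * h / k) : ℝ) : ℂ) * Complex.I := by
    push_cast; ring
  rw [this, Complex.norm_exp_ofReal_mul_I]

lemma mem_sector_iff {k h : ℕ} {R θ : ℝ} (hR : 0 < R) {u : ℂ} :
    u ∈ sector k h R θ ↔ R < ((u ^ k)⁻¹).re ∧
      |Complex.arg (u * Complex.exp (-(2 * Real.pi * h / k * Complex.I)))| < θ := by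
  rw [← norm_sub_lt_iff_lt_re_inv hR]
  rfl

lemma ne_zero_of_mem_sector {k h : ℕ} (hk : 1 ≤ k) {R θ : ℝ} (hR : 0 < R) {u : ℂ}
    (hu : u ∈ sector k h R θ) : u ≠ 0 := by
  rintro rfl
  have := ((mem_sector_iff hR).1 hu).1
  rw [zero_pow (by omega), inv_zero, Complex.zero_re] at this
  linarith

lemma pow_mul_lt_one_of_mem_sector {k : ℕ} {c : ℝ} (hc : 0 < c) {u : ℂ}
    (hu : c < ((u ^ k)⁻¹).re) : ‖u‖ ^ k * c < 1 := by
  have h1 : c < ‖(u ^ k)⁻¹‖ := hu.trans_le (Complex.re_le_norm _)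
  rw [norm_inv, norm_pow] at h1
  have h2 : 0 < ‖u‖ ^ k := inv_pos.1 (hc.trans h1)
  rw [lt_inv_comm₀ hc h2, ← one_div, lt_div_iff₀ hc] at h1
  exact h1

/-! ### One step of the dynamics -/

lemma exists_basin_step {d k l : ℕ} (hd : 1 ≤ d) (hk : 1 ≤ k) (hl : 1 ≤ l)
    {lam : Fin d → ℂ} (hlam : ∀ j, ‖lam j‖ = 1) (hprod : ∏ i, lam i = 1)
    {F : EuclideanSpace ℂ (Fin d) → EuclideanSpace ℂ (Fin d)}
    (hFN : (fun z => F z - normalForm k lam z) =O[𝓝 0] fun z => ‖z‖ ^ l)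
    {β θ : ℝ} (hβ : 0 < β) (hβd : β < 1 / d) (hβl : 2 * (k : ℝ) + 1 < β * ((l : ℝ) + d - 1))
    (hθ : 0 < θ) (hθk : θ < Real.pi / (2 * k)) :
    ∃ r : ℝ, 0 < r ∧ ∀ h : ℕ, ∀ z ∈ regionW d β, coordProd z ≠ 0 → ‖coordProd z‖ < r →
      |Complex.arg (coordProd z * Complex.exp (-(2 * Real.pi * h / k * Complex.I)))| < θ →
      F z ∈ regionW d β ∧
      |Complex.arg (coordProd (F z) * Complex.exp (-(2 * Real.pi * h / k * Complex.I)))| < θ ∧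
      ((coordProd z ^ k)⁻¹).re + 1 / 2 ≤ ((coordProd (F z) ^ k)⁻¹).re := by
  have hd1 : (1 : ℝ) ≤ d := by exact_mod_cast hd
  obtain ⟨C, hC, r₁, hr₁, hest⟩ := exists_local_estimates hd hk hl hlam hprod hFN hβ hβl
  obtain ⟨r₂, hr₂, hsec⟩ := exists_sector_step hk hC hθ hθk
  obtain ⟨r₃, hr₃, hreg⟩ := exists_norm_add_lt_rpow hk hd hC hθ hθk hβ hβd
  refine ⟨min (min r₁ 1) (min r₂ r₃), by positivity, fun h z hz hu0 hur harg => ?_⟩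
  have hur₁ := hur.trans_le ((min_le_left _ _).trans (min_le_left _ _))
  have hx1 := hur.le.trans ((min_le_left _ _).trans (min_le_right _ _))
  have hur₂ := hur.trans_le ((min_le_right _ _).trans (min_le_left _ _))
  have hur₃ := hur.trans_le ((min_le_right _ _).trans (min_le_right _ _))
  obtain ⟨hj, -, hu'⟩ := hest z hz hu0 hur₁
  set ζ := Complex.exp (-(2 * Real.pi * h / k * Complex.I)) with hζ
  have hζk : ζ ^ k = 1 := rotation_pow hk h
  have hζn : ‖ζ‖ = 1 := norm_rotation k h
  set u := coordProd z with hu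
  have hx0 : 0 < ‖u‖ := norm_pos_iff.2 hu0
  have hn : ∀ v : ℂ, ‖v * ζ‖ = ‖v‖ := fun v => by rw [norm_mul, hζn, mul_one]
  have hp : ∀ v : ℂ, (v * ζ) ^ k = v ^ k := fun v => by rw [mul_pow, hζk, mul_one]
  have hw0 : u * ζ ≠ 0 := mul_ne_zero hu0 (Complex.exp_ne_zero _)
  have hww : ‖coordProd (F z) * ζ - u * ζ * (1 - (u * ζ) ^ k / k)‖
      ≤ C * ‖u * ζ‖ ^ (2 * k + 1) := by
    have h1 : coordProd (F z) * ζ - u * ζ * (1 - (u * ζ) ^ k / k)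
        = (coordProd (F z) - u * (1 - u ^ k / k)) * ζ := by rw [hp]; ring
    rw [h1, hn, hn]
    exact hu'
  obtain ⟨-, h2, h3⟩ := hsec (u * ζ) (coordProd (F z) * ζ) hw0 (by rwa [hn]) harg hww
  have h4 := hreg (u * ζ) (coordProd (F z) * ζ) hw0 (by rwa [hn]) harg hww
  rw [hp, hp] at h3
  rw [hp, hn, hn] at h4
  refine ⟨fun j => ?_, h2, h3⟩
  refine lt_of_le_of_lt ?_ h4
  set a := ‖u‖ ^ β with ha
  have ha0 : 0 < a := Real.rpow_pos_of_pos hx0 _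
  -- From `β(l+d-1) > 2k+1` and `βd < 1` follows `β(l-1) > 2k`.
  have h5 : a ^ (l - 1) ≤ ‖u‖ ^ (2 * k) := by
    refine rpow_pow_le_pow hx0 hx1 ?_
    rw [lt_div_iff₀ (by positivity)] at hβd
    rw [Nat.cast_sub hl]
    push_cast
    nlinarith
  have h6 : a ^ l = a * a ^ (l - 1) := by rw [← pow_succ']; congr 1; omega
  have h7 := hj j
  rw [h6] at h7
  calc ‖F z j‖ = ‖lam j * z j * (1 - u ^ k / (k * d))
          + (F z j - lam j * z j * (1 - u ^ k / (k * d)))‖ := by congr 1; ring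
    _ ≤ a * ‖1 - u ^ k / (k * d)‖ + C * (a * a ^ (l - 1)) := by
        refine (norm_add_le _ _).trans (add_le_add ?_ h7)
        rw [norm_mul, norm_mul, hlam, one_mul]
        gcongr
        exact (hz j).le
    _ ≤ a * ‖1 - u ^ k / (k * d)‖ + C * (a * ‖u‖ ^ (2 * k)) := by gcongr
    _ = _ := by ring

/-! ### Local basins -/

lemma continuous_coordProd {d : ℕ} : Continuous (coordProd (d := d)) := by
  unfold coordProd
  fun_prop

lemma isOpen_basin {d k h : ℕ} (hk : 1 ≤ k) {R θ β : ℝ} (hR : 0 < R) (hβ : 0 < β)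
    (hθk : θ < Real.pi / (2 * k)) : IsOpen (basin d k h R θ β) := by
  have hk1 : (1 : ℝ) ≤ k := by exact_mod_cast hk
  have hθπ : θ < Real.pi := hθk.trans_le (div_le_self Real.pi_pos.le (by linarith))
  have hW : IsOpen (regionW d β) := by
    have : regionW d β = ⋂ j, {z | ‖z j‖ < ‖coordProd z‖ ^ β} := by
      ext z; simp [regionW]
    rw [this]
    refine isOpen_iInter_of_finite fun j => isOpen_lt (by fun_prop) ?_
    exact (continuous_coordProd.norm).rpow_const fun _ => Or.inr hβ.le
  have hS : IsOpen (sector k h R θ) := by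
    rw [isOpen_iff_mem_nhds]
    intro u hu
    have hu0 := ne_zero_of_mem_sector hk hR hu
    have h1 : ∀ᶠ v in 𝓝 u, ‖v ^ k - ((1 / (2 * R) : ℝ) : ℂ)‖ < 1 / (2 * R) := by
      have : ContinuousAt (fun v : ℂ => ‖v ^ k - ((1 / (2 * R) : ℝ) : ℂ)‖) u := by fun_prop
      exact this.eventually_lt continuousAt_const hu.1
    have h2 : ∀ᶠ v in 𝓝 u,
        |Complex.arg (v * Complex.exp (-(2 * Real.pi * h / k * Complex.I)))| < θ := by
      have hslit : u * Complex.exp (-(2 * Real.pi * h / k * Complex.I)) ∈ Complex.slitPlane := by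
        rw [Complex.mem_slitPlane_iff_arg]
        refine ⟨?_, mul_ne_zero hu0 (Complex.exp_ne_zero _)⟩
        intro heq
        have := hu.2
        rw [heq, abs_of_pos Real.pi_pos] at this
        linarith
      have : ContinuousAt (fun v : ℂ =>
          |Complex.arg (v * Complex.exp (-(2 * Real.pi * h / k * Complex.I)))|) u :=
        (ContinuousAt.comp (f := fun v : ℂ => v * Complex.exp (-(2 * Real.pi * h / k * Complex.I)))
          (Complex.continuousAt_arg hslit) (by fun_prop)).abs
      exact this.eventually_lt continuousAt_const hu.2
    filter_upwards [h1, h2] with v hv1 hv2 using ⟨hv1, hv2⟩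
  exact hW.inter (hS.preimage continuous_coordProd)

lemma basin_nonempty {d k h : ℕ} (hd : 1 ≤ d) (hk : 1 ≤ k) {R θ β : ℝ} (hR : 0 < R)
    (hβd : β < 1 / d) (hθ : 0 < θ) : (basin d k h R θ β).Nonempty := by
  have hd0 : (0 : ℝ) < d := by exact_mod_cast hd
  set ζ := Complex.exp (-(2 * Real.pi * h / k * Complex.I)) with hζ
  have hζ0 : ζ ≠ 0 := Complex.exp_ne_zero _
  have hζk : ζ ^ k = 1 := rotation_pow hk h
  have hζn : ‖ζ‖ = 1 := norm_rotation k h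
  -- All coordinates get modulus `t < 1`, so `t < t^(dβ)` because `dβ < 1`. One coordinate carries
  -- the rotation, and `t⁻¹ > R` gives the disc condition.
  set t : ℝ := 1 / (R + 2) with ht
  have ht0 : 0 < t := by positivity
  have ht1 : t < 1 := by rw [ht, div_lt_one (by positivity)]; linarith
  let j₀ : Fin d := ⟨0, hd⟩
  let z : EuclideanSpace ℂ (Fin d) := WithLp.toLp 2 fun j => if j = j₀ then t * ζ⁻¹ else t
  have hzj : ∀ j, z j = (t : ℂ) * (if j = j₀ then ζ⁻¹ else 1) := fun j => by
    change (if j = j₀ then (t : ℂ) * ζ⁻¹ else (t : ℂ)) = _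
    split_ifs <;> simp
  have hu : coordProd z = (t : ℂ) ^ d * ζ⁻¹ := by
    unfold coordProd
    simp_rw [hzj]
    rw [Finset.prod_mul_distrib, Finset.prod_const, Finset.card_univ, Fintype.card_fin,
      Finset.prod_ite_eq' Finset.univ j₀ (fun _ => ζ⁻¹), if_pos (Finset.mem_univ _)]
  refine ⟨z, fun j => ?_, (mem_sector_iff hR).2 ⟨?_, ?_⟩⟩
  · have h1 : ‖z j‖ = t := by
      rw [hzj, norm_mul, Complex.norm_real, Real.norm_eq_abs, abs_of_pos ht0]
      split_ifs <;> simp [hζn]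
    have h2 : ‖coordProd z‖ = t ^ d := by
      rw [hu, norm_mul, norm_inv, hζn, inv_one, mul_one, norm_pow, Complex.norm_real,
        Real.norm_eq_abs, abs_of_pos ht0]
    rw [h1, h2, ← Real.rpow_natCast_mul ht0.le]
    conv_lhs => rw [← Real.rpow_one t]
    refine Real.rpow_lt_rpow_of_exponent_gt ht0 ht1 ?_
    rw [lt_div_iff₀ hd0] at hβd
    linarith
  · have h1 : ((coordProd z ^ k)⁻¹) = ((((t ^ d) ^ k)⁻¹ : ℝ) : ℂ) := by
      rw [hu, mul_pow, inv_pow, hζk]; push_cast; simp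
    rw [h1, Complex.ofReal_re]
    have h2 : (t ^ d) ^ k ≤ t := by
      rw [← pow_mul]
      exact pow_le_of_le_one ht0.le ht1.le (Nat.mul_ne_zero (by omega) (by omega))
    calc R < R + 2 := by linarith
      _ = t⁻¹ := by rw [ht]; simp
      _ ≤ _ := by gcongr
  · rw [hu, mul_assoc, inv_mul_cancel₀ hζ0, mul_one, ← Complex.ofReal_pow,
      Complex.arg_ofReal_of_nonneg (by positivity), abs_zero]
    exact hθ

/-- A basin is a uniform local basin of attraction once the real part of `u ^ (-k)` grows linearly
along orbits. -/
lemma isUniformLocalBasin_of_step {d k h : ℕ} (hd : 1 ≤ d) (hk : 1 ≤ k) {R θ β : ℝ} (hR : 0 < R)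
    (hβ : 0 < β) (hβd : β < 1 / d) (hθ : 0 < θ) (hθk : θ < Real.pi / (2 * k))
    {F : EuclideanSpace ℂ (Fin d) → EuclideanSpace ℂ (Fin d)}
    (hstep : ∀ z ∈ basin d k h R θ β, F z ∈ basin d k h R θ β ∧
      ((coordProd z ^ k)⁻¹).re + 1 / 2 ≤ ((coordProd (F z) ^ k)⁻¹).re) :
    IsUniformLocalBasin F (basin d k h R θ β) := by
  have hmaps : Set.MapsTo F (basin d k h R θ β) (basin d k h R θ β) := fun z hz => (hstep z hz).1
  refine ⟨isOpen_basin hk hR hβ hθk, basin_nonempty hd hk hR hβd hθ, hmaps, ?_⟩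
  have hgrow : ∀ n : ℕ, ∀ z ∈ basin d k h R θ β,
      R + n / 2 < ((coordProd (F^[n] z) ^ k)⁻¹).re := by
    intro n z hz
    induction n with
    | zero => simpa using ((mem_sector_iff hR).1 hz.2).1
    | succ n ih =>
      have h1 := (hstep _ (hmaps.iterate n hz)).2
      rw [← Function.iterate_succ_apply' F n z] at h1
      push_cast
      linarith
  have hk0 : (k : ℝ) ≠ 0 := by exact_mod_cast (by omega : k ≠ 0)
  -- This bound on `‖F^[n] z‖` does not involve `z`: `|u_n| ≤ (R + n/2)^(-1/k)` and each coordinate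
  -- is below `|u_n|^β`.
  have hlim : Tendsto (fun n : ℕ => (d : ℝ) * (((R + n / 2)⁻¹ : ℝ) ^ ((k : ℝ)⁻¹)) ^ β) atTop
      (𝓝 0) := by
    have h1 : Tendsto (fun n : ℕ => R + (n : ℝ) / 2) atTop atTop :=
      tendsto_atTop_add_const_left _ _ (tendsto_natCast_atTop_atTop.atTop_div_const two_pos)
    have h2 : Tendsto (fun n : ℕ => ((R + (n : ℝ) / 2)⁻¹)) atTop (𝓝 0) := h1.inv_tendsto_atTop
    have h3 := (h2.rpow_const (p := (k : ℝ)⁻¹) (Or.inr (by positivity))).rpow_const (p := β)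
      (Or.inr hβ.le)
    have h4 := h3.const_mul (d : ℝ)
    rwa [Real.zero_rpow (inv_ne_zero hk0), Real.zero_rpow hβ.ne', mul_zero] at h4
  rw [Metric.tendstoUniformlyOn_iff]
  intro ε hε
  filter_upwards [hlim.eventually_lt_const hε] with n hn z hz
  rw [dist_comm, dist_zero_right]
  refine lt_of_le_of_lt ?_ hn
  have hzn := hmaps.iterate n hz
  have hu : ‖coordProd (F^[n] z)‖ ≤ ((R + n / 2)⁻¹ : ℝ) ^ ((k : ℝ)⁻¹) := by
    have hc : 0 < R + (n : ℝ) / 2 := by positivity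
    have h1 := pow_mul_lt_one_of_mem_sector hc (hgrow n z hz)
    rw [← lt_div_iff₀ hc, one_div] at h1
    rw [Real.le_rpow_inv_iff_of_pos (norm_nonneg _) (by positivity) (by positivity),
      Real.rpow_natCast]
    exact h1.le
  refine norm_le_of_apply_le hd _ (by positivity) fun j => (hzn.1 j).le.trans ?_
  gcongr

theorem exists_isUniformLocalBasin {d k l : ℕ} (hd : 1 ≤ d) (hk : 1 ≤ k) (hl : 1 ≤ l)
    {lam : Fin d → ℂ} (hlam : ∀ j, ‖lam j‖ = 1) (hprod : ∏ i, lam i = 1)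
    {F : EuclideanSpace ℂ (Fin d) → EuclideanSpace ℂ (Fin d)}
    (hFN : (fun z => F z - normalForm k lam z) =O[𝓝 0] fun z => ‖z‖ ^ l)
    {β θ : ℝ} (hβ : 0 < β) (hβd : β < 1 / d) (hβl : 2 * (k : ℝ) + 1 < β * ((l : ℝ) + d - 1))
    (hθ : 0 < θ) (hθk : θ < Real.pi / (2 * k)) :
    ∃ R : ℝ, 0 < R ∧ ∀ h : ℕ, IsUniformLocalBasin F (basin d k h R θ β) := by
  obtain ⟨r, hr, hstep⟩ := exists_basin_step hd hk hl hlam hprod hFN hβ hβd hβl hθ hθk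
  -- With this `R` the disc condition forces `|u| < r`.
  have hR : 0 < (r ^ k)⁻¹ := by positivity
  refine ⟨(r ^ k)⁻¹, hR, fun h =>
    isUniformLocalBasin_of_step hd hk hR hβ hβd hθ hθk fun z hz => ?_⟩
  obtain ⟨hre, harg⟩ := (mem_sector_iff hR).1 hz.2
  have hur : ‖coordProd z‖ < r := by
    have h1 := pow_mul_lt_one_of_mem_sector hR hre
    rw [← div_eq_mul_inv, div_lt_one (by positivity)] at h1
    exact lt_of_pow_lt_pow_left₀ k hr.le h1
  obtain ⟨h1, h2, h3⟩ := hstep h z hz.1 (ne_zero_of_mem_sector hk hR hz.2) hur harg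
  exact ⟨⟨h1, (mem_sector_iff hR).2 ⟨by linarith, h2⟩⟩, h3⟩

/-! ### Asymptotics of orbits -/

/-- Exponential sums with distinct unimodular frequencies do not tend to zero. -/
lemma eq_zero_of_tendsto_sum_mul_pow {d : ℕ} {lam : Fin d → ℂ} (hlam : ∀ j, ‖lam j‖ = 1)
    (hinj : Function.Injective lam) {b : Fin d → ℂ}
    (hb : Tendsto (fun n : ℕ => ∑ j, b j * lam j ^ n) atTop (𝓝 0)) (j : Fin d) : b j = 0 := by
  -- Shifting `n` multiplies the `j`-th term by `lam j`, so polynomials in the shift preserve the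
  -- limit; a Lagrange basis polynomial isolates one term.
  have hpoly : ∀ P : Polynomial ℂ,
      Tendsto (fun n : ℕ => ∑ j, b j * P.eval (lam j) * lam j ^ n) atTop (𝓝 0) := by
    intro P
    induction P using Polynomial.induction_on' with
    | add p q hp hq =>
      have h := hp.add hq
      rw [add_zero] at h
      refine h.congr fun n => ?_
      rw [← Finset.sum_add_distrib]
      refine Finset.sum_congr rfl fun j _ => ?_
      rw [Polynomial.eval_add]; ring
    | monomial m c =>
      have h := ((tendsto_add_atTop_iff_nat m).2 hb).const_mul c
      rw [mul_zero] at h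
      refine h.congr fun n => ?_
      rw [Finset.mul_sum]
      refine Finset.sum_congr rfl fun j _ => ?_
      rw [Polynomial.eval_monomial]; ring
  have h := hpoly (Lagrange.basis Finset.univ lam j)
  have h1 : ∀ n : ℕ, ∑ i, b i * (Lagrange.basis Finset.univ lam j).eval (lam i) * lam i ^ n
      = b j * lam j ^ n := fun n => by
    rw [Finset.sum_eq_single j]
    · rw [Lagrange.eval_basis_self hinj.injOn (Finset.mem_univ j), mul_one]
    · intro i _ hij
      rw [Lagrange.eval_basis_of_ne hij.symm (Finset.mem_univ i), mul_zero, zero_mul]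
    · simp
  simp_rw [h1] at h
  have h2 := h.norm
  simp_rw [norm_mul, norm_pow, hlam, one_pow, mul_one, norm_zero] at h2
  exact norm_eq_zero.1 (tendsto_nhds_unique tendsto_const_nhds h2)

lemma summable_of_re_inv_growth {k : ℕ} {u : ℕ → ℂ} {c : ℝ} (hc : 0 < c)
    (hu : ∀ n : ℕ, c + n / 2 ≤ ((u n ^ k)⁻¹).re) : Summable fun n => ‖u n‖ ^ (2 * k) := by
  -- Gives `m(n + 1) < c + n/2`, strictly because `c / 2 < c`.
  set m := min (c / 2) (1 / 2) with hm
  have hm0 : 0 < m := by positivity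
  have hsum : Summable fun n : ℕ => (m⁻¹) ^ 2 * (1 / ((n + 1 : ℕ) : ℝ) ^ 2) :=
    ((summable_nat_add_iff 1).2 (Real.summable_one_div_nat_pow.2 one_lt_two)).mul_left _
  refine hsum.of_nonneg_of_le (fun n => by positivity) fun n => ?_
  have h1 : m * ((n + 1 : ℕ) : ℝ) < ((u n ^ k)⁻¹).re := by
    refine lt_of_lt_of_le ?_ (hu n)
    push_cast
    have h2 : m ≤ c / 2 := min_le_left _ _
    have h3 : m * n ≤ 1 / 2 * n := by gcongr; exact min_le_right _ _
    linarith
  have h2 := pow_mul_lt_one_of_mem_sector (by positivity) h1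
  have h3 : ‖u n‖ ^ k ≤ m⁻¹ * (1 / ((n + 1 : ℕ) : ℝ)) := by
    rw [← lt_div_iff₀ (by positivity)] at h2
    refine h2.le.trans (le_of_eq ?_)
    field_simp
  calc ‖u n‖ ^ (2 * k) = (‖u n‖ ^ k) ^ 2 := by ring
    _ ≤ (m⁻¹ * (1 / ((n + 1 : ℕ) : ℝ))) ^ 2 := by gcongr
    _ = _ := by ring

/-- A sequence following the normal form up to summable errors behaves, coordinate by coordinate,
like a common scalar times a rotation, with non-zero leading coefficients. -/
lemma exists_coordinate_asymptotics {d k l : ℕ} (hd : 1 ≤ d) (hk : 1 ≤ k)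
    {lam : Fin d → ℂ} (hlam : ∀ j, ‖lam j‖ = 1) (hprod : ∏ i, lam i = 1)
    {β C : ℝ} (hC : 0 ≤ C) (hβd : β < 1 / d)
    (hβl : 2 * (k : ℝ) + 1 < β * ((l : ℝ) + d - 1))
    {y : ℕ → EuclideanSpace ℂ (Fin d)} (hu0 : ∀ n, coordProd (y n) ≠ 0)
    (hu1 : ∀ n, ‖coordProd (y n)‖ ≤ 1 / 2)
    (hsum : Summable fun n => ‖coordProd (y n)‖ ^ (2 * k))
    (hcoord : ∀ n j, ‖y (n + 1) j - lam j * y n j * (1 - coordProd (y n) ^ k / (k * d))‖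
        ≤ C * (‖coordProd (y n)‖ ^ β) ^ l)
    (hu : ∀ n, ‖coordProd (y (n + 1))
        - coordProd (y n) * (1 - coordProd (y n) ^ k / (k * d)) ^ d‖
        ≤ C * ‖coordProd (y n)‖ ^ (2 * k + 1)) :
    ∃ p : ℕ → ℂ, (∀ n, p n ≠ 0) ∧ ∃ x : Fin d → ℂ, (∀ j, x j ≠ 0) ∧
      ∀ j, Tendsto (fun n => y n j / (lam j ^ n * p n)) atTop (𝓝 (x j)) := by
  have hk1 : (1 : ℝ) ≤ k := by exact_mod_cast hk
  have hd1 : (1 : ℝ) ≤ d := by exact_mod_cast hd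
  have hd0 : (0 : ℝ) < d := by linarith
  have hlam0 : ∀ j, lam j ≠ 0 := fun j => norm_pos_iff.1 (by rw [hlam]; exact one_pos)
  set u : ℕ → ℂ := fun n => coordProd (y n) with hudef
  change ∀ n, u n ≠ 0 at hu0
  change ∀ n, ‖u n‖ ≤ 1 / 2 at hu1
  change Summable fun n => ‖u n‖ ^ (2 * k) at hsum
  change ∀ n j, ‖y (n + 1) j - lam j * y n j * (1 - u n ^ k / (k * d))‖
    ≤ C * (‖u n‖ ^ β) ^ l at hcoord
  change ∀ n, ‖u (n + 1) - u n * (1 - u n ^ k / (k * d)) ^ d‖ ≤ C * ‖u n‖ ^ (2 * k + 1) at hu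
  have hupos : ∀ n, 0 < ‖u n‖ := fun n => norm_pos_iff.2 (hu0 n)
  set f : ℕ → ℂ := fun n => 1 - u n ^ k / (k * d) with hf
  have hfn : ∀ n, 1 / 2 ≤ ‖f n‖ := fun n => by
    have h1 : ‖u n ^ k / (k * d)‖ ≤ 1 / 2 := by
      rw [norm_div, norm_mul, Complex.norm_natCast, Complex.norm_natCast, norm_pow]
      refine (div_le_self (by positivity) (by nlinarith)).trans ?_
      exact (pow_le_of_le_one (norm_nonneg _) ((hu1 n).trans (by norm_num)) (by omega)).trans
        (hu1 n)
    have h2 := norm_sub_norm_le (1 : ℂ) (u n ^ k / (k * d))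
    rw [norm_one] at h2
    change 1 / 2 ≤ ‖1 - u n ^ k / (k * d)‖
    linarith
  have hf0 : ∀ n, f n ≠ 0 := fun n => norm_pos_iff.1 (by linarith [hfn n])
  set p : ℕ → ℂ := fun n => ∏ i ∈ Finset.range n, f i with hp
  have hp0 : ∀ n, p n ≠ 0 := fun n => Finset.prod_ne_zero_iff.2 fun i _ => hf0 i
  have hps : ∀ n, p (n + 1) = p n * f n := fun n => Finset.prod_range_succ _ _
  -- The relative error of `u` against its model; it makes `u n / p n ^ d` a partial product of `1 +
  -- ε i`.
  set ε : ℕ → ℂ := fun n => u (n + 1) / (u n * f n ^ d) - 1 with hε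
  have hε1 : ∀ n, 1 + ε n = u (n + 1) / (u n * f n ^ d) := fun n => by
    simp only [hε]; ring
  have hε0 : ∀ n, 1 + ε n ≠ 0 := fun n => by
    rw [hε1]
    exact div_ne_zero (hu0 _) (mul_ne_zero (hu0 _) (pow_ne_zero _ (hf0 _)))
  have hεs : Summable fun n => ‖ε n‖ := by
    refine (hsum.mul_left (C * 2 ^ d)).of_nonneg_of_le (fun n => norm_nonneg _) fun n => ?_
    have h1 : ε n = (u (n + 1) - u n * f n ^ d) / (u n * f n ^ d) := by
      have := mul_ne_zero (hu0 n) (pow_ne_zero d (hf0 n))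
      simp only [hε]
      rw [sub_div, div_self this]
    have h2 : (1 / 2 : ℝ) ^ d ≤ ‖f n‖ ^ d := by gcongr; exact hfn n
    rw [h1, norm_div, norm_mul, norm_pow]
    have h3 := hupos n
    have h4 : 0 < ‖f n‖ := norm_pos_iff.2 (hf0 n)
    rw [div_le_iff₀ (by positivity)]
    calc _ ≤ C * ‖u n‖ ^ (2 * k + 1) := hu n
      _ = C * 2 ^ d * ‖u n‖ ^ (2 * k) * (‖u n‖ * (1 / 2) ^ d) := by
          rw [one_div, inv_pow]; field_simp; ring
      _ ≤ _ := by gcongr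
  have hq : ∀ n, u n / p n ^ d = u 0 * ∏ i ∈ Finset.range n, (1 + ε i) := by
    intro n
    induction n with
    | zero => simp [hp]
    | succ n ih =>
      rw [Finset.prod_range_succ, ← mul_assoc, ← ih, hε1, hps]
      have := hp0 n
      have := hf0 n
      have := hu0 n
      field_simp
      rw [mul_pow, mul_assoc]
  have hqlim : Tendsto (fun n => u n / p n ^ d) atTop (𝓝 (u 0 * ∏' i, (1 + ε i))) := by
    simp_rw [hq]
    exact ((multipliable_one_add_of_summable hεs).hasProd.tendsto_prod_nat).const_mul _
  have hq0 : u 0 * ∏' i, (1 + ε i) ≠ 0 :=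
    mul_ne_zero (hu0 0) (tprod_one_add_ne_zero_of_summable hε0 hεs)
  obtain ⟨Q, hQ⟩ := (Metric.isBounded_range_of_tendsto _ hqlim).exists_norm_le
  have hQ' : ∀ n, ‖u n‖ ≤ Q * ‖p n‖ ^ d := fun n => by
    have h1 := hQ _ (Set.mem_range_self n)
    have h2 : 0 < ‖p n‖ := norm_pos_iff.2 (hp0 n)
    rwa [norm_div, norm_pow, div_le_iff₀ (by positivity)] at h1
  have hQ0 : 0 ≤ Q := (norm_nonneg _).trans (hQ _ (Set.mem_range_self 0))
  have herr : ∀ n, (‖u n‖ ^ β) ^ l ≤ Q ^ (1 / d : ℝ) * ‖p n‖ * ‖u n‖ ^ (2 * k) := fun n => by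
    have h1 : ‖u n‖ ^ (1 / d : ℝ) ≤ Q ^ (1 / d : ℝ) * ‖p n‖ := by
      calc ‖u n‖ ^ (1 / d : ℝ) ≤ (Q * ‖p n‖ ^ d) ^ (1 / d : ℝ) := by gcongr; exact hQ' n
        _ = Q ^ (1 / d : ℝ) * (‖p n‖ ^ d) ^ (1 / d : ℝ) := Real.mul_rpow hQ0 (by positivity)
        _ = _ := by rw [one_div, Real.pow_rpow_inv_natCast (norm_nonneg _) (by omega)]
    -- Since `β(d-1) ≤ 1 - 1/d`, the hypothesis on `β` leaves `βl > 2k + 1/d`. The part `1/d` pays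
    -- for one factor `|p n|`, the part `2k` for summability.
    have h2 : (1 / d : ℝ) + (2 * k : ℕ) ≤ β * l := by
      have h3 : β * (d - 1) ≤ 1 / d * (d - 1) := by
        gcongr
      have h4 : (1 / d : ℝ) * (d - 1) = 1 - 1 / d := by field_simp
      push_cast
      nlinarith
    calc (‖u n‖ ^ β) ^ l = ‖u n‖ ^ (β * l) := by
          rw [Real.rpow_mul (norm_nonneg _), Real.rpow_natCast]
      _ ≤ ‖u n‖ ^ ((1 / d : ℝ) + (2 * k : ℕ)) :=
          Real.rpow_le_rpow_of_exponent_ge (hupos n) ((hu1 n).trans (by norm_num)) h2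
      _ = ‖u n‖ ^ (1 / d : ℝ) * ‖u n‖ ^ (2 * k) := by
          rw [Real.rpow_add (hupos n), Real.rpow_natCast]
      _ ≤ _ := by gcongr
  have hconv : ∀ j, ∃ a, Tendsto (fun n => y n j / (lam j ^ n * p n)) atTop (𝓝 a) := by
    intro j
    refine cauchySeq_tendsto_of_complete (cauchySeq_of_dist_le_of_summable
      (fun n => 2 * C * Q ^ (1 / d : ℝ) * ‖u n‖ ^ (2 * k)) (fun n => ?_) (hsum.mul_left _))
    have hl0 := hlam0 j
    have hpn := hp0 n
    have hfn0 := hf0 n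
    have h1 : y (n + 1) j / (lam j ^ (n + 1) * p (n + 1)) - y n j / (lam j ^ n * p n)
        = (y (n + 1) j - lam j * y n j * f n) / (lam j ^ (n + 1) * (p n * f n)) := by
      rw [hps]
      field_simp
      ring
    have h2 : 0 < ‖p n‖ := norm_pos_iff.2 hpn
    have h3 : 0 < ‖f n‖ := norm_pos_iff.2 hfn0
    rw [dist_comm, dist_eq_norm, h1, norm_div, norm_mul, norm_pow, hlam, one_pow, one_mul, norm_mul,
      div_le_iff₀ (by positivity)]
    calc _ ≤ C * (‖u n‖ ^ β) ^ l := hcoord n j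
      _ ≤ C * (Q ^ (1 / d : ℝ) * ‖p n‖ * ‖u n‖ ^ (2 * k)) := by gcongr; exact herr n
      _ = 2 * C * Q ^ (1 / d : ℝ) * ‖u n‖ ^ (2 * k) * (‖p n‖ * (1 / 2)) := by ring
      _ ≤ _ := by gcongr; exact hfn n
  choose x hx using hconv
  refine ⟨p, hp0, x, ?_, hx⟩
  have hprodx : ∏ j, x j = u 0 * ∏' i, (1 + ε i) := by
    refine tendsto_nhds_unique (tendsto_finsetProd Finset.univ fun j _ => hx j) ?_
    refine hqlim.congr fun n => ?_
    rw [Finset.prod_div_distrib, Finset.prod_mul_distrib, Finset.prod_pow, hprod, one_pow, one_mul,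
      Finset.prod_const, Finset.card_univ, Fintype.card_fin]
    rfl
  intro j
  rw [← hprodx] at hq0
  exact Finset.prod_ne_zero_iff.1 hq0 j (Finset.mem_univ j)

/-- As `‖y n‖ = O(|p n|)`, the form is also `o(|p n|)`; dividing by `p n` leaves the sum of `b j * x
j * lam j ^ n` up to `o(1)`. -/
lemma linearMap_eq_zero_of_asymptotics {d : ℕ} (hd : 1 ≤ d) {lam : Fin d → ℂ}
    (hlam : ∀ j, ‖lam j‖ = 1) (hinj : Function.Injective lam)
    {y : ℕ → EuclideanSpace ℂ (Fin d)} {p : ℕ → ℂ} (hp0 : ∀ n, p n ≠ 0)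
    {x : Fin d → ℂ} (hx0 : ∀ j, x j ≠ 0)
    (hx : ∀ j, Tendsto (fun n => y n j / (lam j ^ n * p n)) atTop (𝓝 (x j)))
    (f : EuclideanSpace ℂ (Fin d) →ₗ[ℂ] ℂ)
    (hf : Tendsto (fun n => f ((‖y n‖⁻¹ : ℝ) • y n)) atTop (𝓝 0)) : f = 0 := by
  have hlam0 : ∀ j, lam j ≠ 0 := fun j => norm_pos_iff.1 (by rw [hlam]; exact one_pos)
  set b : Fin d → ℂ := fun j => f (EuclideanSpace.single j 1) with hb
  have hfb : ∀ v, f v = ∑ j, b j * v j := fun v => by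
    conv_lhs => rw [← (EuclideanSpace.basisFun (Fin d) ℂ).sum_repr v]
    rw [map_sum]
    refine Finset.sum_congr rfl fun j _ => ?_
    rw [map_smul, EuclideanSpace.basisFun_apply, EuclideanSpace.basisFun_repr, smul_eq_mul, mul_comm]
  have hbdd : ∀ j, ∃ M, ∀ n, ‖y n j / (lam j ^ n * p n)‖ ≤ M := fun j => by
    obtain ⟨M, hM⟩ := (Metric.isBounded_range_of_tendsto _ (hx j)).exists_norm_le
    exact ⟨M, fun n => hM _ (Set.mem_range_self n)⟩
  choose M hM using hbdd
  have hM0 : ∀ j, 0 ≤ M j := fun j => (norm_nonneg _).trans (hM j 0)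
  have hy : ∀ n, ‖y n‖ ≤ d * (∑ j, M j) * ‖p n‖ := fun n => by
    have hpn : 0 < ‖p n‖ := norm_pos_iff.2 (hp0 n)
    rw [mul_assoc]
    refine norm_le_of_apply_le hd _
      (mul_nonneg (Finset.sum_nonneg fun j _ => hM0 j) hpn.le) fun j => ?_
    have h1 := hM j n
    rw [norm_div, norm_mul, norm_pow, hlam, one_pow, one_mul, div_le_iff₀ hpn] at h1
    refine h1.trans ?_
    gcongr
    exact Finset.single_le_sum (fun i _ => hM0 i) (Finset.mem_univ j)
  have hlim1 : Tendsto (fun n => f (y n) / p n) atTop (𝓝 0) := by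
    have h1 := hf.norm.mul_const (d * ∑ j, M j)
    rw [norm_zero, zero_mul] at h1
    refine squeeze_zero_norm (fun n => ?_) h1
    have hpn : 0 < ‖p n‖ := norm_pos_iff.2 (hp0 n)
    rw [norm_div, div_le_iff₀ hpn]
    have h2 : y n = ((‖y n‖ : ℝ) : ℂ) • ((‖y n‖⁻¹ : ℝ) • y n) := by
      by_cases h0 : y n = 0
      · simp [h0]
      · rw [Complex.coe_smul, smul_smul, mul_inv_cancel₀ (norm_ne_zero_iff.2 h0), one_smul]
    calc ‖f (y n)‖ = ‖f ((‖y n‖⁻¹ : ℝ) • y n)‖ * ‖y n‖ := by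
          conv_lhs => rw [h2]
          rw [map_smul, norm_smul, Complex.norm_real, norm_norm, mul_comm]
      _ ≤ ‖f ((‖y n‖⁻¹ : ℝ) • y n)‖ * (d * (∑ j, M j) * ‖p n‖) := by gcongr; exact hy n
      _ = _ := by ring
  have hlim2 : Tendsto (fun n : ℕ => ∑ j, b j * x j * lam j ^ n) atTop (𝓝 0) := by
    have h1 : Tendsto (fun n : ℕ => ∑ j, b j * lam j ^ n * (y n j / (lam j ^ n * p n) - x j))
        atTop (𝓝 0) := by
      rw [← Finset.sum_const_zero (s := (Finset.univ : Finset (Fin d)))]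
      refine tendsto_finsetSum _ fun j _ => ?_
      have h2 := ((hx j).sub_const (x j)).norm.const_mul ‖b j‖
      rw [sub_self, norm_zero, mul_zero] at h2
      refine squeeze_zero_norm (fun n => le_of_eq ?_) h2
      rw [norm_mul, norm_mul, norm_pow, hlam, one_pow, mul_one]
    have h3 := hlim1.sub h1
    rw [sub_zero] at h3
    refine h3.congr fun n => ?_
    rw [hfb, Finset.sum_div, ← Finset.sum_sub_distrib]
    refine Finset.sum_congr rfl fun j _ => ?_
    have h4 := hlam0 j
    have h5 := hp0 n
    field_simp
    ring
  have hb0 : ∀ j, b j = 0 := fun j =>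
    (mul_eq_zero.1 (eq_zero_of_tendsto_sum_mul_pow hlam hinj hlim2 j)).resolve_right (hx0 j)
  ext v
  simp [hfb, hb0]

/-! ### Directions -/

lemma tendsto_of_forall_limitDirections {d : ℕ} {x : ℕ → EuclideanSpace ℂ (Fin d)}
    (f : EuclideanSpace ℂ (Fin d) →ₗ[ℂ] ℂ) (hf : ∀ w ∈ limitDirections x, f w = 0) :
    Tendsto (fun n => f ((‖x n‖⁻¹ : ℝ) • x n)) atTop (𝓝 0) := by
  have hcont : Continuous f := f.continuous_of_finiteDimensional
  rw [Metric.tendsto_nhds]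
  intro ε hε
  by_contra hcon
  rw [not_eventually] at hcon
  -- Otherwise the directions would return infinitely often to this compact set and accumulate where
  -- `f` does not vanish.
  have hK : IsCompact (Metric.closedBall (0 : EuclideanSpace ℂ (Fin d)) 1 ∩ {w | ε ≤ ‖f w‖}) :=
    (isCompact_closedBall _ _).inter_right (isClosed_le continuous_const hcont.norm)
  obtain ⟨w, hw, hcl⟩ := hK.exists_mapClusterPt_of_frequently
    (f := fun n => (‖x n‖⁻¹ : ℝ) • x n) (l := atTop) (hcon.mono fun n hn => by
      refine ⟨?_, ?_⟩
      · rw [mem_closedBall_zero_iff, norm_smul, Real.norm_eq_abs, abs_inv, abs_norm]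
        exact inv_mul_le_one
      · rw [dist_zero_right, not_lt] at hn
        exact hn)
  have h1 : ε ≤ ‖f w‖ := hw.2
  rw [hf w hcl, norm_zero] at h1
  linarith

lemma tendsto_of_convergesTangentTo {d : ℕ} {x : ℕ → EuclideanSpace ℂ (Fin d)}
    {V : Submodule ℂ (EuclideanSpace ℂ (Fin d))} (hV : ConvergesTangentTo x V)
    (f : EuclideanSpace ℂ (Fin d) →ₗ[ℂ] ℂ) (hf : V ≤ LinearMap.ker f) :
    Tendsto (fun n => f ((‖x n‖⁻¹ : ℝ) • x n)) atTop (𝓝 0) := by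
  set g := LinearMap.toContinuousLinearMap f with hg
  have hdist : ∀ v, ‖f v‖ ≤ (‖g‖ + 1) * Metric.infDist v (V : Set (EuclideanSpace ℂ (Fin d))) := by
    intro v
    rw [← div_le_iff₀' (by positivity), Metric.le_infDist ⟨0, V.zero_mem⟩]
    intro w hw
    rw [div_le_iff₀' (by positivity)]
    have h1 : f v = g (v - w) := by
      rw [map_sub]
      have : g w = 0 := hf hw
      rw [this, sub_zero]; rfl
    rw [h1, dist_eq_norm]
    refine (g.le_opNorm _).trans ?_
    gcongr
    linarith
  have h1 := (hV.2.tendsto_div_nhds_zero).const_mul (‖g‖ + 1)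
  rw [mul_zero] at h1
  refine squeeze_zero_norm (fun n => ?_) h1
  rw [← Complex.coe_smul, map_smul, norm_smul, Complex.norm_real, Real.norm_eq_abs, abs_inv,
    abs_norm, ← mul_div_assoc, inv_mul_eq_div]
  gcongr
  exact hdist _

/-! ### Orbits in the basins -/

/-- A linear form that is `o(‖z‖)` along an orbit in a basin vanishes. -/
theorem linearMap_eq_zero_of_orbit {d k l : ℕ} (hd : 1 ≤ d) (hk : 1 ≤ k) (hl : 1 ≤ l)
    {lam : Fin d → ℂ} (hlam : ∀ j, ‖lam j‖ = 1) (hprod : ∏ i, lam i = 1)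
    (hinj : Function.Injective lam)
    {F : EuclideanSpace ℂ (Fin d) → EuclideanSpace ℂ (Fin d)}
    (hFN : (fun z => F z - normalForm k lam z) =O[𝓝 0] fun z => ‖z‖ ^ l)
    {β θ R : ℝ} (hβ : 0 < β) (hβd : β < 1 / d) (hβl : 2 * (k : ℝ) + 1 < β * ((l : ℝ) + d - 1))
    (hθ : 0 < θ) (hθk : θ < Real.pi / (2 * k)) (hR : 0 < R) {h : ℕ}
    (hbasin : IsUniformLocalBasin F (basin d k h R θ β))
    {z : EuclideanSpace ℂ (Fin d)} (hz : z ∈ basin d k h R θ β)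
    (f : EuclideanSpace ℂ (Fin d) →ₗ[ℂ] ℂ)
    (hf : Tendsto (fun n => f ((‖F^[n] z‖⁻¹ : ℝ) • F^[n] z)) atTop (𝓝 0)) : f = 0 := by
  obtain ⟨C, hC, r₁, hr₁, hest⟩ := exists_local_estimates hd hk hl hlam hprod hFN hβ hβl
  obtain ⟨r₂, hr₂, hstep⟩ := exists_basin_step hd hk hl hlam hprod hFN hβ hβd hβl hθ hθk
  have hmem : ∀ n, F^[n] z ∈ basin d k h R θ β := fun n => hbasin.mapsTo.iterate n hz
  have hlim : Tendsto (fun n => F^[n] z) atTop (𝓝 0) := hbasin.tendsto_zero.tendsto_at hz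
  have hulim : Tendsto (fun n => ‖coordProd (F^[n] z)‖) atTop (𝓝 0) := by
    have h0 : coordProd (0 : EuclideanSpace ℂ (Fin d)) = 0 :=
      Finset.prod_eq_zero (Finset.mem_univ (⟨0, hd⟩ : Fin d)) rfl
    have h1 := ((continuous_coordProd (d := d)).tendsto 0).comp hlim
    rw [h0] at h1
    simpa using h1.norm
  -- `R` is arbitrary here, so the estimates near 0 apply only to a tail of the orbit; a shift does
  -- not affect the limit of `f`.
  obtain ⟨N, hN⟩ := eventually_atTop.1
    (hulim.eventually_lt_const (show 0 < min (min r₁ r₂) (1 / 2) by positivity))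
  set y : ℕ → EuclideanSpace ℂ (Fin d) := fun n => F^[n + N] z with hy
  have hys : ∀ n, y (n + 1) = F (y n) := fun n => by
    simp only [hy]
    rw [← Function.iterate_succ_apply' F]; congr 1; omega
  have hymem : ∀ n, y n ∈ basin d k h R θ β := fun n => hmem _
  have hy0 : ∀ n, coordProd (y n) ≠ 0 := fun n => ne_zero_of_mem_sector hk hR (hymem n).2
  have hyr : ∀ n, ‖coordProd (y n)‖ < min (min r₁ r₂) (1 / 2) := fun n => hN _ (by omega)
  have hyr₁ : ∀ n, ‖coordProd (y n)‖ < r₁ := fun n =>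
    (hyr n).trans_le ((min_le_left _ _).trans (min_le_left _ _))
  have hyr₂ : ∀ n, ‖coordProd (y n)‖ < r₂ := fun n =>
    (hyr n).trans_le ((min_le_left _ _).trans (min_le_right _ _))
  have hgrow : ∀ n : ℕ, R + n / 2 ≤ ((coordProd (y n) ^ k)⁻¹).re := by
    intro n
    induction n with
    | zero => simpa using ((mem_sector_iff hR).1 (hymem 0).2).1.le
    | succ n ih =>
      have h1 := (hstep h (y n) (hymem n).1 (hy0 n) (hyr₂ n) (hymem n).2.2).2.2
      rw [← hys] at h1
      push_cast
      linarith
  have hestn := fun n => hest (y n) (hymem n).1 (hy0 n) (hyr₁ n)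
  simp_rw [← hys] at hestn
  obtain ⟨p, hp0, x, hx0, hx⟩ := exists_coordinate_asymptotics hd hk hlam hprod hC hβd hβl hy0
    (fun n => (hyr n).le.trans (min_le_right _ _)) (summable_of_re_inv_growth hR hgrow)
    (fun n => (hestn n).1) (fun n => (hestn n).2.1)
  exact linearMap_eq_zero_of_asymptotics hd hlam hinj hp0 hx0 hx f
    ((tendsto_add_atTop_iff_nat N).2 hf)

end OneResonantBasins

theorem mainTheorem8 (d k l : ℕ) (hd : 1 ≤ d) (hk : 1 ≤ k) (hl : 2 * k * d + 1 < l)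
    (lam : Fin d → ℂ) (hlam : ∀ j, ‖lam j‖ = 1)
    (hres : OneResonantBasins.OneResonant (fun _ => 1) lam)
    (F : EuclideanSpace ℂ (Fin d) → EuclideanSpace ℂ (Fin d)) (hF : AnalyticAt ℂ F 0)
    (hFN : (fun z => F z - OneResonantBasins.normalForm k lam z) =O[𝓝 0] fun z => ‖z‖ ^ l)
    (β θ : ℝ) (hβ : 0 < β) (hβd : β < 1 / d) (hβl : 2 * (k : ℝ) + 1 < β * ((l : ℝ) + d - 1))
    (hθ : 0 < θ) (hθk : θ < Real.pi / (2 * k)) :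
    (∃ R : ℝ, 0 < R ∧ ∀ h < k,
      OneResonantBasins.IsUniformLocalBasin F (OneResonantBasins.basin d k h R θ β)) ∧
    ∀ R : ℝ, 0 < R →
      (∀ h < k,
        OneResonantBasins.IsUniformLocalBasin F (OneResonantBasins.basin d k h R θ β)) →
      ∀ h < k, ∀ z ∈ OneResonantBasins.basin d k h R θ β,
        (∀ V : Submodule ℂ (EuclideanSpace ℂ (Fin d)), V ≠ ⊤ →
          ¬ OneResonantBasins.ConvergesTangentTo (fun n => F^[n] z) V) ∧
        Submodule.span ℂ (OneResonantBasins.limitCone fun n => F^[n] z) = ⊤ := by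
  have hprod := hres.prod_eq_one hd hlam
  have hl1 : 1 ≤ l := by omega
  refine ⟨?_, fun R hR hB h hh z hz => ?_⟩
  · obtain ⟨R, hR, hB⟩ := OneResonantBasins.exists_isUniformLocalBasin hd hk hl1 hlam hprod hFN
      hβ hβd hβl hθ hθk
    exact ⟨R, hR, fun h _ => hB h⟩
  have key := OneResonantBasins.linearMap_eq_zero_of_orbit hd hk hl1 hlam hprod hres.injective hFN
    hβ hβd hβl hθ hθk hR (hB h hh) hz
  refine ⟨fun V hV hT => ?_, ?_⟩
  · obtain ⟨f, hf0, hf⟩ := V.exists_le_ker_of_lt_top hV.lt_top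
    exact hf0 (key f (OneResonantBasins.tendsto_of_convergesTangentTo hT f hf))
  · by_contra hspan
    obtain ⟨f, hf0, hf⟩ := Submodule.exists_le_ker_of_lt_top _ (lt_top_iff_ne_top.2 hspan)
    exact hf0 (key f (OneResonantBasins.tendsto_of_forall_limitDirections f fun w hw =>
      hf (Submodule.subset_span ⟨1, zero_le_one, w, hw, (one_smul ℝ w).symm⟩)))
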